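/- Let $d\in\mathbb N$ and let $\Omega\subset\mathbb R^d$ be open. **Colombeau algebra.** For $f\in C^\infty(\Omega)$ (complex valued), $K\subset\Omega$ compact and $l\in\mathbb N$ put $p_{K,l}(f)=\sup_{x\in K,\,|\alpha|\le l}|\partial^\alpha f(x)|$. Let $\mathcal F(C^\infty(\Omega))$ be the algebra of nets $(f_\varepsilon)_\varepsilon\in C^\infty(\Omega)^{(0,1]}$ such that for all $l$ and all compact $K\subset\Omega$ there is $q\in\mathbb N$ with $p_{K,l}(f_\varepsilon)=o(\varepsilon^{-q})$ as $\varepsilon\to0$, and let $\mathcal N(C^\infty(\Omega))$ be its ideal of nets such that $p_{K,l}(f_\varepsilon)=o(\varepsilon^{p})$ for all $l$, all compact $K\subset\Omega$ and all $p\in\mathbb N$. Let $\mathcal G(\Omega)=\mathcal F(C^\infty(\Omega))/\mathcal N(C^\infty(\Omega))$, write $[(f_\varepsilon)_\varepsilon]$ for the class of a net, and let $\sigma:C^\infty(\Omega)\to\mathcal G(\Omega)$, $\sigma(f)=[(f)_\varepsilon]$ (constant net). **Mollifiers.** Let $\rho\in\mathcal S(\mathbb R^d)$ be even with $\int\rho(x)\,dx=1$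 and $\int x^m\rho(x)\,dx=0$ for all $m\in\mathbb N^d\setminus\{0\}$. Let $\chi\in\mathcal D(\mathbb R^d)$ with $0\le\chi\le1$, $\chi(x)=1$ for $|x|\le1$ and $\chi(x)=0$ for $|x|\ge2$. Put $\theta_\varepsilon(x)=\varepsilon^{-d}\rho(x/\varepsilon)\,\chi(x|\ln\varepsilon|)$ for $0<\varepsilon<1$, and $\theta_1=1$. **Cutoffs.** For $\varepsilon\in(0,1]$ let $K_\varepsilon=\{x\in\Omega : d(x,\mathbb R^d\setminus\Omega)\ge\varepsilon,\ |x|\le1/\varepsilon\}$ (with $d(x,\emptyset)=+\infty$), and let $\kappa_\varepsilon\in\mathcal D(\Omega)$ with $0\le\kappa_\varepsilon\le1$ and $\kappa_\varepsilon=1$ on $K_\varepsilon$. For $T\in\mathcal D'(\Omega)$ and $y\in\Omega$ let $((\kappa_\varepsilon T)*\theta_\varepsilon)(y)=\langle T,\ x\mapsto\kappa_\varepsilon(x)\,\theta_\varepsilon(y-x)\rangle$. **Proposition.** For every $T\in\mathcal D'(\Omega)$ the net $((\kappa_\varepsilon T)*\theta_\varepsilon)_\varepsilon$ belongs to $\mathcal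 F(C^\infty(\Omega))$, and the map $$\iota_S:\mathcal D'(\Omega)\to\mathcal G(\Omega),\qquad T\mapsto\big[((\kappa_\varepsilon T)*\theta_\varepsilon)_\varepsilon\big]$$ is $\mathbb C$-linear and injective. Moreover $\iota_S(f)=\sigma(f)$ for every $f\in C^\infty(\Omega)$, where $f$ is identified with the distribution $\varphi\mapsto\int_\Omega f\varphi\,dx$. -/

import Mathlib

open scoped Distributions ContDiff SchwartzMap

noncomputable section

namespace Colombeau

open TopologicalSpace MeasureTheory Asymptotics Filter Topology

variable {d : ℕ}

/-! ### Smooth functions on an open set -/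

/-- Extension by zero of a function on `Ω` to the whole space (only used to differentiate and to
integrate inside `Ω`). -/
def zeroExt (Ω : Opens (EuclideanSpace ℝ (Fin d))) (f : Ω → ℂ) : EuclideanSpace ℝ (Fin d) → ℂ :=
  Function.extend (Subtype.val : Ω → EuclideanSpace ℝ (Fin d)) f 0

theorem zeroExt_apply {Ω : Opens (EuclideanSpace ℝ (Fin d))} (f : Ω → ℂ) (x : Ω) :
    zeroExt Ω f x = f x :=
  Subtype.val_injective.extend_apply f 0 x

theorem zeroExt_add {Ω : Opens (EuclideanSpace ℝ (Fin d))} (f g : Ω → ℂ) :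
    zeroExt Ω (f + g) = zeroExt Ω f + zeroExt Ω g := by
  simpa [zeroExt] using
    Function.extend_add (Subtype.val : Ω → EuclideanSpace ℝ (Fin d)) f g (0 : EuclideanSpace ℝ (Fin d) → ℂ) 0

theorem zeroExt_mul {Ω : Opens (EuclideanSpace ℝ (Fin d))} (f g : Ω → ℂ) :
    zeroExt Ω (f * g) = zeroExt Ω f * zeroExt Ω g := by
  simpa [zeroExt] using
    Function.extend_mul (Subtype.val : Ω → EuclideanSpace ℝ (Fin d)) f g (0 : EuclideanSpace ℝ (Fin d) → ℂ) 0

/-- `C^∞(Ω)`: the algebra of complex valued smooth functions on the open set `Ω ⊆ ℝ^d`. -/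
def SmoothFn (Ω : Opens (EuclideanSpace ℝ (Fin d))) : Subalgebra ℂ (Ω → ℂ) where
  carrier := {f | ContDiffOn ℝ ∞ (zeroExt Ω f) Ω}
  add_mem' {f g} hf hg := by
    have h : ContDiffOn ℝ ∞ (zeroExt Ω f + zeroExt Ω g) Ω := ContDiffOn.add hf hg
    rwa [← zeroExt_add] at h
  mul_mem' {f g} hf hg := by
    have h : ContDiffOn ℝ ∞ (zeroExt Ω f * zeroExt Ω g) Ω := ContDiffOn.mul hf hg
    rwa [← zeroExt_mul] at h
  algebraMap_mem' c :=
    (contDiffOn_const (c := c)).congr fun x hx => zeroExt_apply _ (⟨x, hx⟩ : Ω)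

/-- `p_{K,l}(f)`: the supremum over `x ∈ K` of the derivatives of `f` of all orders `≤ l` at `x`.
The derivatives of order `i` are measured together, by the norm of the `i`-th Fréchet derivative. -/
def smoothSeminorm {Ω : Opens (EuclideanSpace ℝ (Fin d))} (K : Set (EuclideanSpace ℝ (Fin d)))
    (l : ℕ) (f : SmoothFn Ω) : ℝ :=
  sSup {r : ℝ | ∃ i ≤ l, ∃ x ∈ K, r = ‖iteratedFDeriv ℝ i (zeroExt Ω f) x‖}

section seminorm

variable {Ω : Opens (EuclideanSpace ℝ (Fin d))} {K : Set (EuclideanSpace ℝ (Fin d))} {l : ℕ}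

theorem iteratedFDeriv_zeroExt (f : Ω → ℂ) (i : ℕ) {x : EuclideanSpace ℝ (Fin d)} (hx : x ∈ Ω) :
    iteratedFDeriv ℝ i (zeroExt Ω f) x = iteratedFDerivWithin ℝ i (zeroExt Ω f) Ω x :=
  (iteratedFDerivWithin_of_isOpen i Ω.isOpen hx).symm

theorem le_smoothSeminorm (hK : IsCompact K) (hKΩ : K ⊆ Ω) (f : SmoothFn Ω) {i : ℕ} (hi : i ≤ l)
    {x : EuclideanSpace ℝ (Fin d)} (hx : x ∈ K) :
    ‖iteratedFDeriv ℝ i (zeroExt Ω f) x‖ ≤ smoothSeminorm K l f := by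
  refine le_csSup ?_ ⟨i, hi, x, hx, rfl⟩
  have h : ∀ j : ℕ, ∃ C, ∀ y ∈ K, ‖iteratedFDeriv ℝ j (zeroExt Ω f) y‖ ≤ C := by
    intro j
    refine hK.exists_bound_of_continuousOn ?_
    have h1 : ContinuousOn (iteratedFDerivWithin ℝ j (zeroExt Ω f) Ω) Ω :=
      ContDiffOn.continuousOn_iteratedFDerivWithin f.2 (mod_cast le_top) Ω.isOpen.uniqueDiffOn
    exact (h1.mono hKΩ).congr fun y hy => iteratedFDeriv_zeroExt _ _ (hKΩ hy)
  choose C hC using h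
  refine ⟨∑ j ∈ Finset.range (l + 1), |C j|, ?_⟩
  rintro r ⟨j, hj, y, hy, rfl⟩
  refine (hC j y hy).trans ((le_abs_self _).trans ?_)
  exact Finset.single_le_sum (f := fun j => |C j|) (fun _ _ => abs_nonneg _)
    (Finset.mem_range.2 (Nat.lt_succ_of_le hj))

theorem smoothSeminorm_le {f : SmoothFn Ω} {C : ℝ} (hC : 0 ≤ C)
    (h : ∀ i ≤ l, ∀ x ∈ K, ‖iteratedFDeriv ℝ i (zeroExt Ω f) x‖ ≤ C) :
    smoothSeminorm K l f ≤ C := by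
  refine Real.sSup_le ?_ hC
  rintro r ⟨i, hi, x, hx, rfl⟩
  exact h i hi x hx

theorem smoothSeminorm_nonneg (f : SmoothFn Ω) : 0 ≤ smoothSeminorm K l f := by
  refine Real.sSup_nonneg ?_
  rintro r ⟨i, hi, x, hx, rfl⟩
  exact norm_nonneg _

theorem smoothSeminorm_add_le (hK : IsCompact K) (hKΩ : K ⊆ Ω) (f g : SmoothFn Ω) :
    smoothSeminorm K l (f + g) ≤ smoothSeminorm K l f + smoothSeminorm K l g := by
  refine smoothSeminorm_le (add_nonneg (smoothSeminorm_nonneg _) (smoothSeminorm_nonneg _)) ?_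
  intro i hi x hx
  have h : iteratedFDeriv ℝ i (zeroExt Ω (f + g : SmoothFn Ω)) x =
      iteratedFDeriv ℝ i (zeroExt Ω f) x + iteratedFDeriv ℝ i (zeroExt Ω g) x := by
    rw [Subalgebra.coe_add, zeroExt_add, ← zeroExt_add, iteratedFDeriv_zeroExt _ _ (hKΩ hx),
      iteratedFDeriv_zeroExt _ _ (hKΩ hx), iteratedFDeriv_zeroExt _ _ (hKΩ hx), zeroExt_add]
    exact iteratedFDerivWithin_add_apply
      ((f.2 x (hKΩ hx)).of_le (mod_cast le_top)) ((g.2 x (hKΩ hx)).of_le (mod_cast le_top))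
      Ω.isOpen.uniqueDiffOn (hKΩ hx)
  rw [h]
  exact (norm_add_le _ _).trans
    (add_le_add (le_smoothSeminorm hK hKΩ f hi hx) (le_smoothSeminorm hK hKΩ g hi hx))

theorem smoothSeminorm_mul_le (hK : IsCompact K) (hKΩ : K ⊆ Ω) (f g : SmoothFn Ω) :
    smoothSeminorm K l (f * g) ≤ 2 ^ l * (smoothSeminorm K l f * smoothSeminorm K l g) := by
  have h0 := mul_nonneg (smoothSeminorm_nonneg (K := K) (l := l) f)
    (smoothSeminorm_nonneg (K := K) (l := l) g)
  refine smoothSeminorm_le (by positivity) ?_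
  intro i hi x hx
  rw [Subalgebra.coe_mul, iteratedFDeriv_zeroExt _ _ (hKΩ hx), zeroExt_mul]
  refine (norm_iteratedFDerivWithin_mul_le (n := i) (N := ∞) f.2 g.2 Ω.isOpen.uniqueDiffOn
    (hKΩ hx) (mod_cast le_top)).trans ?_
  have h1 : ∑ j ∈ Finset.range (i + 1), (i.choose j : ℝ) *
        ‖iteratedFDerivWithin ℝ j (zeroExt Ω f) Ω x‖ *
        ‖iteratedFDerivWithin ℝ (i - j) (zeroExt Ω g) Ω x‖ ≤
      ∑ j ∈ Finset.range (i + 1), (i.choose j : ℝ) *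
        (smoothSeminorm K l f * smoothSeminorm K l g) := by
    refine Finset.sum_le_sum fun j hj => ?_
    have hj' : j ≤ i := Nat.lt_succ_iff.1 (Finset.mem_range.1 hj)
    rw [mul_assoc, ← iteratedFDeriv_zeroExt _ _ (hKΩ hx), ← iteratedFDeriv_zeroExt _ _ (hKΩ hx)]
    exact mul_le_mul_of_nonneg_left
      (mul_le_mul (le_smoothSeminorm hK hKΩ f (hj'.trans hi) hx)
        (le_smoothSeminorm hK hKΩ g ((Nat.sub_le _ _).trans hi) hx) (norm_nonneg _)
        (smoothSeminorm_nonneg _)) (Nat.cast_nonneg _)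
  refine h1.trans ?_
  rw [← Finset.sum_mul]
  refine mul_le_mul_of_nonneg_right ?_ h0
  have h2 : ∑ j ∈ Finset.range (i + 1), (i.choose j : ℝ) = 2 ^ i := by
    exact_mod_cast Nat.sum_range_choose i
  rw [h2]
  exact pow_le_pow_right₀ (by norm_num) hi

end seminorm

/-! ### The Colombeau algebra -/

/-- The filter `ε → 0` on the index set `(0, 1]`. -/
def atZero : Filter (Set.Ioc (0 : ℝ) 1) :=
  comap Subtype.val (𝓝 0)

/-- `C^∞(Ω)^{(0,1]}`: nets `(f_ε)_{0 < ε ≤ 1}` of smooth functions on `Ω`. -/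
def Net (Ω : Opens (EuclideanSpace ℝ (Fin d))) : Type :=
  Set.Ioc (0 : ℝ) 1 → SmoothFn Ω

instance (Ω : Opens (EuclideanSpace ℝ (Fin d))) : CommRing (Net Ω) :=
  inferInstanceAs (CommRing (Set.Ioc (0 : ℝ) 1 → SmoothFn Ω))

instance (Ω : Opens (EuclideanSpace ℝ (Fin d))) : Algebra ℂ (Net Ω) :=
  inferInstanceAs (Algebra ℂ (Set.Ioc (0 : ℝ) 1 → SmoothFn Ω))

/-- Moderate nets: for all `l` and all compact `K ⊆ Ω`, `p_{K,l}(f_ε) = o(ε^{-q})` for some `q`. -/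
def IsModerate {Ω : Opens (EuclideanSpace ℝ (Fin d))} (f : Net Ω) : Prop :=
  ∀ (l : ℕ) (K : Set (EuclideanSpace ℝ (Fin d))), IsCompact K → K ⊆ Ω → ∃ q : ℕ,
    (fun ε => smoothSeminorm K l (f ε)) =o[atZero] fun ε => ((ε : ℝ) ^ q)⁻¹

/-- Negligible nets: for all `l`, all compact `K ⊆ Ω` and all `p`, `p_{K,l}(f_ε) = o(ε^p)`. -/
def IsNegligible {Ω : Opens (EuclideanSpace ℝ (Fin d))} (f : Net Ω) :
    Prop :=
  ∀ (l : ℕ) (K : Set (EuclideanSpace ℝ (Fin d))), IsCompact K → K ⊆ Ω → ∀ p : ℕ,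
    (fun ε => smoothSeminorm K l (f ε)) =o[atZero] fun ε => (ε : ℝ) ^ p

section closure

variable {Ω : Opens (EuclideanSpace ℝ (Fin d))}

theorem isBigO_inv_pow {q r : ℕ} (h : q ≤ r) :
    (fun ε : Set.Ioc (0 : ℝ) 1 => ((ε : ℝ) ^ q)⁻¹) =O[atZero] fun ε => ((ε : ℝ) ^ r)⁻¹ := by
  refine IsBigO.of_bound 1 (Eventually.of_forall fun ε => ?_)
  have h0 : (0 : ℝ) < ε := ε.2.1
  rw [one_mul, Real.norm_of_nonneg (by positivity), Real.norm_of_nonneg (by positivity)]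
  exact inv_anti₀ (by positivity) (pow_le_pow_of_le_one h0.le ε.2.2 h)

theorem isLittleO_const_inv (c : ℝ) :
    (fun _ : Set.Ioc (0 : ℝ) 1 => c) =o[atZero] fun ε => ((ε : ℝ) ^ 1)⁻¹ := by
  rw [isLittleO_const_left]
  right
  have h : Tendsto (Subtype.val : Set.Ioc (0 : ℝ) 1 → ℝ) atZero (𝓝[>] 0) := by
    rw [tendsto_nhdsWithin_iff]
    exact ⟨tendsto_comap, Eventually.of_forall fun ε => ε.2.1⟩
  have h2 := (tendsto_inv_nhdsGT_zero.comp h)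
  refine tendsto_norm_atTop_atTop.comp ?_
  simpa [Function.comp_def] using h2

theorem isModerate_const (f : SmoothFn Ω) : IsModerate (Ω := Ω) fun _ => f :=
  fun _ _ _ _ => ⟨1, isLittleO_const_inv _⟩

theorem IsModerate.add {f g : Net Ω} (hf : IsModerate f)
    (hg : IsModerate g) : IsModerate (f + g) := by
  intro l K hK hKΩ
  obtain ⟨q, hq⟩ := hf l K hK hKΩ
  obtain ⟨r, hr⟩ := hg l K hK hKΩ
  refine ⟨max q r, IsBigO.trans_isLittleO (IsBigO.of_bound 1 (Eventually.of_forall fun ε => ?_))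
    ((hq.trans_isBigO (isBigO_inv_pow (le_max_left q r))).add
      (hr.trans_isBigO (isBigO_inv_pow (le_max_right q r))))⟩
  rw [one_mul, Real.norm_of_nonneg (smoothSeminorm_nonneg _), Real.norm_of_nonneg
    (add_nonneg (smoothSeminorm_nonneg _) (smoothSeminorm_nonneg _))]
  exact smoothSeminorm_add_le hK hKΩ _ _

theorem norm_smoothSeminorm_mul_le {K : Set (EuclideanSpace ℝ (Fin d))} (hK : IsCompact K)
    (hKΩ : K ⊆ Ω) (l : ℕ) (f g : SmoothFn Ω) :
    ‖smoothSeminorm K l (f * g)‖ ≤ 2 ^ l * ‖smoothSeminorm K l f * smoothSeminorm K l g‖ := by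
  rw [Real.norm_of_nonneg (smoothSeminorm_nonneg _), Real.norm_of_nonneg
    (mul_nonneg (smoothSeminorm_nonneg _) (smoothSeminorm_nonneg _))]
  exact smoothSeminorm_mul_le hK hKΩ _ _

theorem IsModerate.mul {f g : Net Ω} (hf : IsModerate f)
    (hg : IsModerate g) : IsModerate (f * g) := by
  intro l K hK hKΩ
  obtain ⟨q, hq⟩ := hf l K hK hKΩ
  obtain ⟨r, hr⟩ := hg l K hK hKΩ
  have h : (fun ε : Set.Ioc (0 : ℝ) 1 => ((ε : ℝ) ^ (q + r))⁻¹) =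
      fun ε : Set.Ioc (0 : ℝ) 1 => ((ε : ℝ) ^ q)⁻¹ * ((ε : ℝ) ^ r)⁻¹ := by
    funext ε
    rw [pow_add, mul_inv]
  refine ⟨q + r, ?_⟩
  rw [h]
  exact IsBigO.trans_isLittleO (IsBigO.of_bound (2 ^ l) (Eventually.of_forall fun ε =>
    norm_smoothSeminorm_mul_le hK hKΩ l (f ε) (g ε))) (hq.mul hr)

theorem IsNegligible.add {f g : Net Ω} (hf : IsNegligible f)
    (hg : IsNegligible g) : IsNegligible (f + g) := by
  intro l K hK hKΩ p
  refine IsBigO.trans_isLittleO (IsBigO.of_bound 1 (Eventually.of_forall fun ε => ?_))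
    ((hf l K hK hKΩ p).add (hg l K hK hKΩ p))
  rw [one_mul, Real.norm_of_nonneg (smoothSeminorm_nonneg _), Real.norm_of_nonneg
    (add_nonneg (smoothSeminorm_nonneg _) (smoothSeminorm_nonneg _))]
  exact smoothSeminorm_add_le hK hKΩ _ _

theorem IsNegligible.zero : IsNegligible (0 : Net Ω) := by
  intro l K hK hKΩ p
  have h : ∀ ε : Set.Ioc (0 : ℝ) 1,
      smoothSeminorm K l ((0 : Net Ω) ε) = 0 := by
    intro ε
    refine le_antisymm (smoothSeminorm_le le_rfl fun i _ x _ => ?_) (smoothSeminorm_nonneg _)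
    have h0 : zeroExt Ω ((0 : SmoothFn Ω) : Ω → ℂ) = 0 := by
      simpa using zeroExt_add (Ω := Ω) 0 0
    change ‖iteratedFDeriv ℝ i (zeroExt Ω ((0 : SmoothFn Ω) : Ω → ℂ)) x‖ ≤ 0
    rw [h0]
    simp
  simp only [h]
  exact isLittleO_zero _ _

theorem IsModerate.mul_isNegligible {f g : Net Ω} (hf : IsModerate f)
    (hg : IsNegligible g) : IsNegligible (f * g) := by
  intro l K hK hKΩ p
  obtain ⟨q, hq⟩ := hf l K hK hKΩ
  have h : (fun ε : Set.Ioc (0 : ℝ) 1 => (ε : ℝ) ^ p) =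
      fun ε : Set.Ioc (0 : ℝ) 1 => ((ε : ℝ) ^ q)⁻¹ * (ε : ℝ) ^ (q + p) := by
    funext ε
    have h0 : (ε : ℝ) ≠ 0 := ε.2.1.ne'
    rw [pow_add]
    field_simp
  rw [h]
  exact IsBigO.trans_isLittleO (IsBigO.of_bound (2 ^ l) (Eventually.of_forall fun ε =>
    norm_smoothSeminorm_mul_le hK hKΩ l (f ε) (g ε))) (hq.mul (hg l K hK hKΩ (q + p)))

end closure

/-- `F(C^∞(Ω))`: the algebra of moderate nets. -/
def Moderate (Ω : Opens (EuclideanSpace ℝ (Fin d))) : Subalgebra ℂ (Net Ω) where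
  carrier := {f | IsModerate f}
  add_mem' hf hg := IsModerate.add hf hg
  mul_mem' hf hg := IsModerate.mul hf hg
  algebraMap_mem' c := isModerate_const (algebraMap ℂ (SmoothFn Ω) c)

/-- `N(C^∞(Ω))`: the negligible nets, an ideal of the algebra of moderate nets. -/
def Negligible (Ω : Opens (EuclideanSpace ℝ (Fin d))) : Ideal (Moderate Ω) where
  carrier := {f | IsNegligible (f : Net Ω)}
  add_mem' hf hg := IsNegligible.add hf hg
  zero_mem' := IsNegligible.zero
  smul_mem' f _ hg := IsModerate.mul_isNegligible f.2 hg

/-- `G(Ω) = F(C^∞(Ω)) / N(C^∞(Ω))`: the simplified Colombeau algebra on `Ω`. -/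
abbrev G (Ω : Opens (EuclideanSpace ℝ (Fin d))) : Type :=
  Moderate Ω ⧸ Negligible Ω

/-- The class `[(f_ε)_ε]` in `G(Ω)` of a moderate net. -/
def cls {Ω : Opens (EuclideanSpace ℝ (Fin d))} (f : Moderate Ω) : G Ω :=
  Ideal.Quotient.mk (Negligible Ω) f

/-- The canonical map `σ : C^∞(Ω) → G(Ω)`, sending `f` to the class of the constant net `f`. -/
def sigma {Ω : Opens (EuclideanSpace ℝ (Fin d))} (f : SmoothFn Ω) : G Ω :=
  cls ⟨fun _ => f, isModerate_const f⟩

/-! ### Distributions -/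

/-- `D'(Ω)`: the continuous `ℂ`-linear forms on the space `D(Ω)` of complex valued test functions
(with its canonical LF topology). -/
abbrev Distr (Ω : Opens (EuclideanSpace ℝ (Fin d))) : Type :=
  𝓓(Ω, ℂ) →L[ℂ] ℂ

theorem locallyIntegrableOn_zeroExt {Ω : Opens (EuclideanSpace ℝ (Fin d))} (f : SmoothFn Ω) :
    LocallyIntegrableOn (zeroExt Ω f) Ω :=
  (ContDiffOn.continuousOn f.2).locallyIntegrableOn Ω.isOpen.measurableSet

/-- The regular distribution `φ ↦ ∫_Ω φ f` attached to a smooth function `f` on `Ω`. -/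
def ofSmooth {Ω : Opens (EuclideanSpace ℝ (Fin d))} (f : SmoothFn Ω) : Distr Ω :=
  TestFunction.integralAgainstBilinCLM (ContinuousLinearMap.mul ℂ ℂ) volume (zeroExt Ω f)

theorem ofSmooth_apply {Ω : Opens (EuclideanSpace ℝ (Fin d))} (f : SmoothFn Ω) (φ : 𝓓(Ω, ℂ)) :
    ofSmooth f φ = ∫ x, φ x * zeroExt Ω f x :=
  TestFunction.integralAgainstBilinCLM_eq_integral (locallyIntegrableOn_zeroExt f)

/-- The test function `κ ψ` on `Ω`, for a cutoff `κ ∈ D(Ω)` and a smooth function `ψ` on `ℝ^d`. -/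
def cutMul {Ω : Opens (EuclideanSpace ℝ (Fin d))} (κ : 𝓓(Ω, ℝ)) (ψ : EuclideanSpace ℝ (Fin d) → ℂ)
    (hψ : ContDiff ℝ ∞ ψ) : 𝓓(Ω, ℂ) where
  toFun x := κ x • ψ x
  contDiff' := κ.contDiff.smul hψ
  hasCompactSupport' := κ.hasCompactSupport.smul_right
  tsupport_subset' := (tsupport_smul_subset_left κ ψ).trans κ.tsupport_subset

/-- The convolution `(κT) ∗ θ` of the compactly supported distribution `κT` (which acts on smooth
functions by `⟨κT, ψ⟩ = ⟨T, κψ⟩`) with the smooth function `θ`, that is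
`((κT) ∗ θ)(y) = ⟨κT, x ↦ θ(y - x)⟩`. -/
def cutConv {Ω : Opens (EuclideanSpace ℝ (Fin d))} (κ : 𝓓(Ω, ℝ)) (T : Distr Ω)
    (θ : EuclideanSpace ℝ (Fin d) → ℂ) (hθ : ContDiff ℝ ∞ θ) (y : EuclideanSpace ℝ (Fin d)) : ℂ :=
  T (cutMul κ (fun x => θ (y - x)) (hθ.comp (contDiff_const.sub contDiff_id)))

/-! ### Mollifiers and cutoffs -/

/-- `θ_ε(x) = ε^{-d} ρ(x/ε) χ(x |ln ε|)` for `0 < ε < 1`, and `θ_1 = 1`. -/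
def theta (ρ : 𝓢(EuclideanSpace ℝ (Fin d), ℂ))
    (χ : 𝓓((⊤ : Opens (EuclideanSpace ℝ (Fin d))), ℝ)) (ε : Set.Ioc (0 : ℝ) 1)
    (x : EuclideanSpace ℝ (Fin d)) : ℂ :=
  if (ε : ℝ) = 1 then 1
  else ((((ε : ℝ) ^ d)⁻¹ : ℝ) : ℂ) * ρ ((ε : ℝ)⁻¹ • x) * ((χ (|Real.log ε| • x) : ℝ) : ℂ)

theorem contDiff_theta (ρ : 𝓢(EuclideanSpace ℝ (Fin d), ℂ))
    (χ : 𝓓((⊤ : Opens (EuclideanSpace ℝ (Fin d))), ℝ)) (ε : Set.Ioc (0 : ℝ) 1) :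
    ContDiff ℝ ∞ (theta ρ χ ε) := by
  unfold theta
  by_cases h : (ε : ℝ) = 1
  · simp only [h, if_true]
    exact contDiff_const
  · simp only [h, if_false]
    refine (contDiff_const.mul ((ρ.smooth ⊤).comp (contDiff_const_smul _))).mul ?_
    exact Complex.ofRealCLM.contDiff.comp (χ.contDiff.comp (contDiff_const_smul _))

/-- `K_ε = {x ∈ Ω : d(x, ℝ^d ∖ Ω) ≥ ε, |x| ≤ 1/ε}`, the distance to the empty set being `+∞`. -/
def exhaustion (Ω : Opens (EuclideanSpace ℝ (Fin d))) (ε : ℝ) : Set (EuclideanSpace ℝ (Fin d)) :=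
  {x | x ∈ Ω ∧ ENNReal.ofReal ε ≤ Metric.infEDist x (Ω : Set (EuclideanSpace ℝ (Fin d)))ᶜ ∧
    ‖x‖ ≤ 1 / ε}

end Colombeau

end

/-! Everything rests on one localization and one approximation estimate. The support of `θ_ε` lies
in a ball of radius `2 / |ln ε|`, which shrinks to a point, and the sets `K_ε` exhaust `Ω`. So over
a compact `K ⊆ Ω` and for small `ε`, the test functions `x ↦ θ_ε (y - x)` live in one fixed compact
`K' ⊆ Ω` on which `κ_ε = 1`: the cutoff disappears from every estimate, and `T` acts with a fixed
order and a fixed constant (`exists_localization`, `Distr.exists_bound`).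

Moderateness: derivatives in `y` fall on `θ_ε`, and each derivative costs at most a factor `ε⁻¹`
beyond the initial `ε^{-d}` (`exists_norm_iteratedFDeriv_theta_le`).

Approximation (`exists_norm_conv_theta_sub_le`): after rescaling, `θ_ε * u - u` compares `ρ(z) χ(δ
z) u(y - ε z)` with `ρ(z)` times a Taylor polynomial of `u`, where `δ = ε |ln ε|`. All
positive-degree terms integrate to zero by the moment conditions. The Taylor error is a high power
of `ε`; the truncation error is the same power of `δ`, hence still a high power of `ε`, since `δ² ≤
4 ε`. Applied to a smooth `f` cut off outside a neighbourhood of `K`, this gives `ι_S f = σ f`.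

Injectivity: let `θ̌` be the reflected mollifier. Then `∫ φ ((κ_ε T) * θ_ε) = ⟨κ_ε T, φ * θ̌_ε⟩`.
The left side tends to zero if the net is negligible, and the right side tends to `⟨T, φ⟩` by the
approximation estimate. Interchanging `T` with the integral (`integral_mul_smoothing`) goes through
Hahn–Banach: the functional is extended to a Banach space of jets, where it commutes with the
Bochner integral. -/

namespace Colombeau

open TopologicalSpace MeasureTheory Asymptotics Filter Topology

/-! ### Smooth functions with bounded derivatives, and the first order Taylor remainder. -/

section Calculus

variable {E : Type} [NormedAddCommGroup E] [NormedSpace ℝ E]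

theorem contDiff_fderiv_apply_const {F : Type} [NormedAddCommGroup F] [NormedSpace ℝ F]
    {f : E → F} (hf : ContDiff ℝ ∞ f) (v : E) : ContDiff ℝ ∞ fun x => fderiv ℝ f x v :=
  (hf.fderiv_right (m := ∞) (by simp)).clm_apply contDiff_const

theorem iteratedFDeriv_succ_apply_eq_fderiv_apply {F : Type} [NormedAddCommGroup F]
    [NormedSpace ℝ F] {f : E → F} (hf : ContDiff ℝ ∞ f) (n : ℕ) (x : E) (m : Fin (n + 1) → E) :
    iteratedFDeriv ℝ (n + 1) f x m =
      iteratedFDeriv ℝ n (fun y => fderiv ℝ f y (m (Fin.last n))) x (Fin.init m) := by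
  rw [iteratedFDeriv_succ_apply_right,
    iteratedFDeriv_clm_apply_const_apply (hf.fderiv_right (m := ∞) (by simp)) (mod_cast le_top)]

theorem contDiff_iteratedFDeriv_apply {F : Type} [NormedAddCommGroup F] [NormedSpace ℝ F]
    {f : E → F} (hf : ContDiff ℝ ∞ f) (n : ℕ) (m : Fin n → E) :
    ContDiff ℝ ∞ fun x => iteratedFDeriv ℝ n f x m :=
  (ContinuousMultilinearMap.apply ℝ (fun _ : Fin n => E) F m).contDiff.comp
    (hf.iteratedFDeriv_right (m := ∞) (by exact_mod_cast le_top))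

/-- Estimates on tensor-valued derivatives are obtained by fixing directions `m`, which keeps
functions complex valued; this controls the price in terms of `∏ i, ‖m i‖`. -/
theorem norm_iteratedFDeriv_iteratedFDeriv_apply_le {F : Type} [NormedAddCommGroup F]
    [NormedSpace ℝ F] (k n : ℕ) (x : E) {f : E → F} (hf : ContDiff ℝ ∞ f) (m : Fin n → E) :
    ‖iteratedFDeriv ℝ k (fun y => iteratedFDeriv ℝ n f y m) x‖ ≤
      ‖iteratedFDeriv ℝ (n + k) f x‖ * ∏ i, ‖m i‖ := by
  induction n generalizing f with
  | zero => rw [Nat.zero_add]; simp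
  | succ n ih =>
    simp only [iteratedFDeriv_succ_apply_eq_fderiv_apply hf]
    refine (ih (contDiff_fderiv_apply_const hf _) _).trans ?_
    rw [Fin.prod_univ_castSucc, mul_comm (∏ i : Fin n, _), ← mul_assoc]
    refine mul_le_mul_of_nonneg_right ?_ (by positivity)
    refine (norm_iteratedFDeriv_clm_apply_const (N := ∞)
      (hf.fderiv_right (m := ∞) (by simp)).contDiffAt (mod_cast le_top)).trans ?_
    rw [norm_iteratedFDeriv_fderiv, mul_comm, show n + k + 1 = n + 1 + k by ring]

/-- Smooth functions all of whose derivatives are bounded. -/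
def IsBddSmooth {F : Type} [NormedAddCommGroup F] [NormedSpace ℝ F] (f : E → F) : Prop :=
  ContDiff ℝ ∞ f ∧ ∀ i : ℕ, ∃ C : ℝ, ∀ x, ‖iteratedFDeriv ℝ i f x‖ ≤ C

theorem isBddSmooth_of_hasCompactSupport {F : Type} [NormedAddCommGroup F] [NormedSpace ℝ F]
    {f : E → F} (hf : ContDiff ℝ ∞ f) (hs : HasCompactSupport f) : IsBddSmooth f :=
  ⟨hf, fun i => (hs.iteratedFDeriv (𝕜 := ℝ) i).exists_bound_of_continuous
    (hf.continuous_iteratedFDeriv (mod_cast le_top))⟩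

theorem isBddSmooth_const {F : Type} [NormedAddCommGroup F] [NormedSpace ℝ F] (c : F) :
    IsBddSmooth fun _ : E => c := by
  refine ⟨contDiff_const, fun i => ?_⟩
  rcases i with _ | i
  · exact ⟨‖c‖, fun x => by simp⟩
  · exact ⟨0, fun x => by rw [iteratedFDeriv_const_of_ne (by simp)]; simp⟩

section

variable {F : Type} [NormedAddCommGroup F] [NormedSpace ℝ F] {f g : E → F}

theorem IsBddSmooth.add (hf : IsBddSmooth f) (hg : IsBddSmooth g) : IsBddSmooth (f + g) := by
  refine ⟨hf.1.add hg.1, fun i => ?_⟩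
  obtain ⟨A, hA⟩ := hf.2 i
  obtain ⟨B, hB⟩ := hg.2 i
  refine ⟨A + B, fun x => ?_⟩
  rw [iteratedFDeriv_add_apply (hf.1.of_le (mod_cast le_top)).contDiffAt
    (hg.1.of_le (mod_cast le_top)).contDiffAt]
  exact (norm_add_le _ _).trans (add_le_add (hA x) (hB x))

theorem IsBddSmooth.const_smul {f : E → ℂ} (hf : IsBddSmooth f) (c : ℂ) : IsBddSmooth (c • f) := by
  refine ⟨contDiff_const.smul hf.1, fun i => ?_⟩
  obtain ⟨A, hA⟩ := hf.2 i
  refine ⟨‖c‖ * A, fun x => ?_⟩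
  rw [iteratedFDeriv_const_smul_apply (hf.1.of_le (mod_cast le_top)).contDiffAt, norm_smul]
  exact mul_le_mul_of_nonneg_left (hA x) (norm_nonneg _)

theorem IsBddSmooth.fderiv (hf : IsBddSmooth f) : IsBddSmooth (fderiv ℝ f) := by
  refine ⟨hf.1.fderiv_right (m := ∞) (by simp), fun i => ?_⟩
  obtain ⟨A, hA⟩ := hf.2 (i + 1)
  exact ⟨A, fun x => norm_iteratedFDeriv_fderiv.trans_le (hA x)⟩

theorem IsBddSmooth.iteratedFDeriv_apply (hf : IsBddSmooth f) (n : ℕ) (m : Fin n → E) :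
    IsBddSmooth fun x => iteratedFDeriv ℝ n f x m := by
  refine ⟨contDiff_iteratedFDeriv_apply hf.1 n m, fun i => ?_⟩
  obtain ⟨A, hA⟩ := hf.2 (n + i)
  exact ⟨A * ∏ i, ‖m i‖, fun x => (norm_iteratedFDeriv_iteratedFDeriv_apply_le i n x hf.1 m).trans
    (mul_le_mul_of_nonneg_right (hA x) (by positivity))⟩

theorem IsBddSmooth.fderiv_apply (hf : IsBddSmooth f) (v : E) :
    IsBddSmooth fun x => _root_.fderiv ℝ f x v := by
  simpa [iteratedFDeriv_one_apply] using hf.iteratedFDeriv_apply 1 fun _ => v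

theorem IsBddSmooth.comp_add_right (hf : IsBddSmooth f) (a : E) :
    IsBddSmooth fun x => f (x + a) := by
  refine ⟨hf.1.comp (contDiff_id.add contDiff_const), fun i => ?_⟩
  obtain ⟨A, hA⟩ := hf.2 i
  exact ⟨A, fun x => by rw [iteratedFDeriv_comp_add_right]; exact hA _⟩

theorem IsBddSmooth.comp_sub (hf : IsBddSmooth f) (a : E) :
    IsBddSmooth fun x => f (x - a) := by
  simpa [sub_eq_add_neg] using hf.comp_add_right (-a)

theorem norm_iteratedFDeriv_comp_neg (i : ℕ) (f : E → F) (x : E) :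
    ‖iteratedFDeriv ℝ i (fun y => f (-y)) x‖ = ‖iteratedFDeriv ℝ i f (-x)‖ :=
  LinearIsometryEquiv.norm_iteratedFDeriv_comp_right (LinearIsometryEquiv.neg ℝ) f x i

theorem IsBddSmooth.comp_neg (hf : IsBddSmooth f) : IsBddSmooth fun x => f (-x) := by
  refine ⟨hf.1.comp contDiff_neg, fun i => ?_⟩
  obtain ⟨A, hA⟩ := hf.2 i
  exact ⟨A, fun x => by rw [norm_iteratedFDeriv_comp_neg]; exact hA _⟩

theorem norm_iteratedFDeriv_sub_le_of_bound (hf : ContDiff ℝ ∞ f) {i : ℕ} {C : ℝ}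
    (hC : ∀ x, ‖iteratedFDeriv ℝ (i + 1) f x‖ ≤ C) (x y : E) :
    ‖iteratedFDeriv ℝ i f x - iteratedFDeriv ℝ i f y‖ ≤ C * ‖x - y‖ := by
  refine Convex.norm_image_sub_le_of_norm_fderiv_le (𝕜 := ℝ) (s := Set.univ)
    (fun z _ => (hf.differentiable_iteratedFDeriv (by exact_mod_cast WithTop.coe_lt_top i)) z)
    (fun z _ => ?_) convex_univ (Set.mem_univ _) (Set.mem_univ _)
  rw [norm_fderiv_iteratedFDeriv]
  exact hC z

/-- The first order Taylor remainder. -/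
noncomputable def taylorRem (f : E → F) (v : E) (z : E) : F := f (z + v) - f z - fderiv ℝ f z v

end

/-- Differentiation commutes with forming the remainder, so order `a + 1` for `f` is order `a` for
its derivative. The target space `F` is quantified inside because it changes at each step of the
induction. -/
theorem IsBddSmooth.norm_iteratedFDeriv_taylorRem_le (a : ℕ) :
    ∀ {F : Type} [NormedAddCommGroup F] [NormedSpace ℝ F] {f : E → F}, IsBddSmooth f →
      ∃ C : ℝ, ∀ v z : E, ‖iteratedFDeriv ℝ a (taylorRem f v) z‖ ≤ C * ‖v‖ ^ 2 := by
  induction a with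
  | zero =>
    intro F _ _ f hf
    obtain ⟨C, hC⟩ := hf.fderiv.2 1
    refine ⟨C, fun v z => ?_⟩
    have hC0 : 0 ≤ C := (norm_nonneg _).trans (hC 0)
    rw [norm_iteratedFDeriv_zero]
    have h := Convex.norm_image_sub_le_of_norm_hasFDerivWithin_le' (𝕜 := ℝ) (f := f)
      (s := segment ℝ z (z + v)) (f' := _root_.fderiv ℝ f) (φ := _root_.fderiv ℝ f z)
      (C := C * ‖v‖) (x := z) (y := z + v)
      (fun x _ => (hf.1.differentiable (by simp) x).hasFDerivAt.hasFDerivWithinAt)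
      (fun x hx => ?_) (convex_segment _ _) (left_mem_segment _ _ _) (right_mem_segment _ _ _)
    · simpa [taylorRem, sq, mul_assoc] using h
    · have h2 : ‖_root_.fderiv ℝ f x - _root_.fderiv ℝ f z‖ ≤ C * ‖x - z‖ :=
        Convex.norm_image_sub_le_of_norm_fderiv_le (𝕜 := ℝ) (s := Set.univ)
          (fun w _ => hf.fderiv.1.differentiable (by simp) w)
          (fun w _ => (norm_iteratedFDeriv_one _).symm.trans_le (hC w))
          convex_univ (Set.mem_univ _) (Set.mem_univ _)
      refine h2.trans (mul_le_mul_of_nonneg_left ?_ hC0)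
      simpa using norm_sub_le_of_mem_segment hx
  | succ a ih =>
    intro F _ _ f hf
    obtain ⟨C, hC⟩ := ih hf.fderiv
    refine ⟨C, fun v z => ?_⟩
    rw [← norm_iteratedFDeriv_fderiv]
    have h : _root_.fderiv ℝ (taylorRem f v) = taylorRem (_root_.fderiv ℝ f) v := by
      funext x
      have hd : Differentiable ℝ f := hf.1.differentiable (by simp)
      have hd2 : Differentiable ℝ (_root_.fderiv ℝ f) := hf.fderiv.1.differentiable (by simp)
      have h1 : HasFDerivAt (fun z => f (z + v)) (_root_.fderiv ℝ f (x + v)) x := by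
        simpa using (hasFDerivAt_comp_add_right v).2 (hd (x + v)).hasFDerivAt
      have h2 : HasFDerivAt (fun z => _root_.fderiv ℝ f z v)
          ((_root_.fderiv ℝ (_root_.fderiv ℝ f) x).flip v) x := by
        simpa using (hd2 x).hasFDerivAt.clm_apply (hasFDerivAt_const v x)
      have h3 := ((h1.sub (hd x).hasFDerivAt).sub h2).fderiv
      -- Symmetry of the second derivative is what makes the two operations commute.
      have h4 : (_root_.fderiv ℝ (_root_.fderiv ℝ f) x).flip v =
          _root_.fderiv ℝ (_root_.fderiv ℝ f) x v := by
        ext w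
        exact (hf.1.contDiffAt.isSymmSndFDerivAt (by
          simp only [minSmoothness_of_isRCLikeNormedField]
          exact ENat.LEInfty.out)) w v
      rw [h4] at h3
      exact h3
    rw [h]
    exact hC v z

end Calculus

/-! ### Smoothing by a linear form of finite order. -/

section Functional

variable {E : Type} [NormedAddCommGroup E] [NormedSpace ℝ E]

variable (E) in
/-- The space of complex valued smooth functions with bounded derivatives. -/
def BddSmooth : Submodule ℂ (E → ℂ) where
  carrier := {f | IsBddSmooth f}
  add_mem' hf hg := hf.add hg
  zero_mem' := isBddSmooth_const 0
  smul_mem' c _ hf := hf.const_smul c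

/-- The translate `x ↦ f (x - y)`. -/
def translate (f : BddSmooth E) (y : E) : BddSmooth E :=
  ⟨fun x => (f : E → ℂ) (x - y), IsBddSmooth.comp_sub f.2 y⟩

/-- The iterated directional derivative. -/
noncomputable def dirDerivs (f : BddSmooth E) (n : ℕ) (m : Fin n → E) : BddSmooth E :=
  ⟨fun x => iteratedFDeriv ℝ n (f : E → ℂ) x m, IsBddSmooth.iteratedFDeriv_apply f.2 n m⟩

/-- The directional derivative. -/
noncomputable def dirDeriv (f : BddSmooth E) (v : E) : BddSmooth E :=
  ⟨fun x => fderiv ℝ (f : E → ℂ) x v, IsBddSmooth.fderiv_apply f.2 v⟩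

theorem dirDerivs_succ (f : BddSmooth E) (n : ℕ) (m : Fin (n + 1) → E) :
    dirDerivs f (n + 1) m = dirDerivs (dirDeriv f (m (Fin.last n))) n (Fin.init m) :=
  Subtype.ext (funext fun x => iteratedFDeriv_succ_apply_eq_fderiv_apply f.2.1 n x m)

/-- The linear form `L` is bounded by `C` times the supremum of the derivatives of order `≤ N`. -/
def SeminormBound (L : BddSmooth E →ₗ[ℂ] ℂ) (N : ℕ) (C : ℝ) : Prop :=
  ∀ (ψ : BddSmooth E) (M : ℝ), (∀ i ≤ N, ∀ x, ‖iteratedFDeriv ℝ i (ψ : E → ℂ) x‖ ≤ M) →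
    ‖L ψ‖ ≤ C * M

/-- The function `y ↦ ⟨L, x ↦ η (x - y)⟩`. -/
def smoothing (L : BddSmooth E →ₗ[ℂ] ℂ) (η : BddSmooth E) (y : E) : ℂ := L (translate η y)

variable [FiniteDimensional ℝ E] {L : BddSmooth E →ₗ[ℂ] ℂ} {N : ℕ} {C : ℝ}

/-- By linearity the error of the first order expansion is `L` of a Taylor remainder of `η`; all
derivatives of that remainder up to order `N` are `O(‖v‖²)`, uniformly in space. -/
theorem hasFDerivAt_smoothing (hL : SeminormBound L N C) (η : BddSmooth E) (y : E) :
    ∃ D : E →L[ℝ] ℂ, (∀ v, D v = -smoothing L (dirDeriv η v) y) ∧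
      HasFDerivAt (smoothing L η) D y := by
  let D : E →ₗ[ℝ] ℂ :=
    { toFun := fun v => -smoothing L (dirDeriv η v) y
      map_add' := fun v w => by
        have : translate (dirDeriv η (v + w)) y =
            translate (dirDeriv η v) y + translate (dirDeriv η w) y :=
          Subtype.ext (funext fun x => map_add (fderiv ℝ (η : E → ℂ) (x - y)) v w)
        simp only [smoothing, this, map_add]
        ring
      map_smul' := fun c v => by
        have : translate (dirDeriv η (c • v)) y = (c : ℂ) • translate (dirDeriv η v) y :=
          Subtype.ext (funext fun x => map_smul (fderiv ℝ (η : E → ℂ) (x - y)) c v)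
        simp only [smoothing, this, map_smul]
        simp }
  refine ⟨LinearMap.toContinuousLinearMap D, fun v => rfl, ?_⟩
  choose B hB using fun a => IsBddSmooth.norm_iteratedFDeriv_taylorRem_le a η.2
  have key : ∀ v : E, ‖smoothing L η (y + v) - smoothing L η y - D v‖ ≤
      C * ((∑ a ∈ Finset.range (N + 1), |B a|) * ‖v‖ ^ 2) := by
    intro v
    have h1 : smoothing L η (y + v) - smoothing L η y - D v =
        L (translate η (y + v) - translate η y + translate (dirDeriv η v) y) := by
      simp [smoothing, D]
    -- Moving `y` by `v` moves the argument of `η` by `-v`, which explains the sign in `D`.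
    have h2 : ((translate η (y + v) - translate η y + translate (dirDeriv η v) y :
        BddSmooth E) : E → ℂ) = fun x => taylorRem (η : E → ℂ) (-v) (x - y) := by
      funext x
      change (η : E → ℂ) (x - (y + v)) - (η : E → ℂ) (x - y) + fderiv ℝ (η : E → ℂ) (x - y) v =
        (η : E → ℂ) (x - y + -v) - (η : E → ℂ) (x - y) - fderiv ℝ (η : E → ℂ) (x - y) (-v)
      rw [map_neg, sub_neg_eq_add, sub_add_eq_sub_sub, sub_eq_add_neg (x - y) v]
    rw [h1]
    refine hL _ _ fun i hi x => ?_
    rw [h2, iteratedFDeriv_comp_sub]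
    refine (hB i (-v) (x - y)).trans ?_
    rw [norm_neg]
    refine mul_le_mul_of_nonneg_right ((le_abs_self _).trans ?_) (by positivity)
    exact Finset.single_le_sum (f := fun j => |B j|) (fun _ _ => abs_nonneg _)
      (Finset.mem_range.2 (Nat.lt_succ_of_le hi))
  rw [hasFDerivAt_iff_isLittleO_nhds_zero]
  refine IsBigO.trans_isLittleO (g := fun v : E => ‖v‖ ^ 2)
    (IsBigO.of_bound (C * ∑ a ∈ Finset.range (N + 1), |B a|) (Eventually.of_forall fun v => ?_)) ?_
  · refine (key v).trans (le_of_eq ?_)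
    rw [norm_pow, norm_norm, mul_assoc]
  · exact isLittleO_norm_pow_id one_lt_two

theorem fderiv_smoothing (hL : SeminormBound L N C) (η : BddSmooth E) (y v : E) :
    fderiv ℝ (smoothing L η) y v = -smoothing L (dirDeriv η v) y := by
  obtain ⟨D, hD, h⟩ := hasFDerivAt_smoothing hL η y
  rw [h.fderiv, hD]

theorem contDiff_smoothing (hL : SeminormBound L N C) (η : BddSmooth E) :
    ContDiff ℝ ∞ (smoothing L η) := by
  refine contDiff_infty.2 fun n => ?_
  induction n generalizing η with
  | zero =>
    refine contDiff_zero.2 (Differentiable.continuous (𝕜 := ℝ) fun y => ?_)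
    obtain ⟨D, -, h⟩ := hasFDerivAt_smoothing hL η y
    exact h.differentiableAt
  | succ n ih =>
    refine contDiff_succ_iff_fderiv_apply.2 ⟨fun y => ?_,
      fun h => absurd h (WithTop.natCast_ne_top n), fun v => ?_⟩
    · obtain ⟨D, -, h⟩ := hasFDerivAt_smoothing hL η y
      exact h.differentiableAt
    · simp only [fderiv_smoothing hL]
      exact (ih _).neg

theorem iteratedFDeriv_smoothing_apply (hL : SeminormBound L N C) (η : BddSmooth E) (n : ℕ)
    (m : Fin n → E) (y : E) :
    iteratedFDeriv ℝ n (smoothing L η) y m = (-1) ^ n * smoothing L (dirDerivs η n m) y := by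
  induction n generalizing η with
  | zero =>
    have : dirDerivs η 0 m = η := Subtype.ext (funext fun x => by simp [dirDerivs])
    simp [this]
  | succ n ih =>
    rw [iteratedFDeriv_succ_apply_eq_fderiv_apply (contDiff_smoothing hL η)]
    simp only [fderiv_smoothing hL]
    have : (fun y => -smoothing L (dirDeriv η (m (Fin.last n))) y) =
      -smoothing L (dirDeriv η (m (Fin.last n))) := rfl
    rw [this, iteratedFDeriv_neg_apply]
    change -(iteratedFDeriv ℝ n _ y (Fin.init m)) = _
    rw [ih, dirDerivs_succ]
    ring

end Functional

/-! ### Differentiating convolutions with a compactly supported smooth factor. -/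

section Convolution

variable {E : Type} [NormedAddCommGroup E] [NormedSpace ℝ E] [MeasureSpace E] [BorelSpace E]

/-- The convolution of two complex valued functions. -/
noncomputable def conv (f g : E → ℂ) (x : E) : ℂ := ∫ t, f t * g (x - t)

variable {f g : E → ℂ}

theorem contDiff_conv (hf : LocallyIntegrable f) (hg : ContDiff ℝ ∞ g)
    (hgc : HasCompactSupport g) : ContDiff ℝ ∞ (conv f g) :=
  hgc.contDiff_convolution_right (n := ⊤) (ContinuousLinearMap.mul ℝ ℂ) hf hg

variable [FiniteDimensional ℝ E] [(volume : Measure E).IsAddHaarMeasure]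

theorem fderiv_conv_apply (hf : LocallyIntegrable f) (hg : ContDiff ℝ ∞ g)
    (hgc : HasCompactSupport g) (x v : E) :
    fderiv ℝ (conv f g) x v = conv f (fun y => fderiv ℝ g y v) x := by
  have h := hgc.hasFDerivAt_convolution_right (ContinuousLinearMap.mul ℝ ℂ) hf
    (hg.of_le (by simp)) x
  have h2 : fderiv ℝ (conv f g) x = _ := h.fderiv
  rw [h2, convolution_precompR_apply (ContinuousLinearMap.mul ℝ ℂ) hf (hgc.fderiv ℝ)
    (hg.continuous_fderiv (by simp))]
  rfl

theorem iteratedFDeriv_conv_apply (hf : LocallyIntegrable f) (hg : ContDiff ℝ ∞ g)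
    (hgc : HasCompactSupport g) (n : ℕ) (x : E) (m : Fin n → E) :
    iteratedFDeriv ℝ n (conv f g) x m = conv f (fun y => iteratedFDeriv ℝ n g y m) x := by
  induction n generalizing g with
  | zero => simp
  | succ n ih =>
    rw [iteratedFDeriv_succ_apply_eq_fderiv_apply (contDiff_conv hf hg hgc)]
    have h : (fun y => fderiv ℝ (conv f g) y (m (Fin.last n))) =
        conv f (fun y => fderiv ℝ g y (m (Fin.last n))) :=
      funext fun y => fderiv_conv_apply hf hg hgc y _
    rw [h, ih (contDiff_fderiv_apply_const hg _) (hgc.fderiv_apply ℝ _)]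
    simp only [iteratedFDeriv_succ_apply_eq_fderiv_apply hg]

end Convolution

/-! ### Jets as elements of a Banach space, and extension of linear forms. -/

section Jet

open scoped BoundedContinuousFunction

variable {E : Type} [NormedAddCommGroup E] [NormedSpace ℝ E]

variable (E) in
/-- The Banach space of families of bounded continuous functions with values in the `i`-linear
forms, `i ≤ N`. -/
def JetSpace (N : ℕ) : Type := (i : Fin (N + 1)) → E →ᵇ E [×(i : ℕ)]→L[ℝ] ℂ

set_option synthInstance.maxHeartbeats 400000 in
noncomputable instance (N : ℕ) : NormedAddCommGroup (JetSpace E N) :=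
  inferInstanceAs (NormedAddCommGroup ((i : Fin (N + 1)) → E →ᵇ E [×(i : ℕ)]→L[ℝ] ℂ))

set_option synthInstance.maxHeartbeats 400000 in
noncomputable instance (N : ℕ) : NormedSpace ℂ (JetSpace E N) :=
  inferInstanceAs (NormedSpace ℂ ((i : Fin (N + 1)) → E →ᵇ E [×(i : ℕ)]→L[ℝ] ℂ))

set_option synthInstance.maxHeartbeats 400000 in
instance (N : ℕ) : CompleteSpace (JetSpace E N) :=
  inferInstanceAs (CompleteSpace ((i : Fin (N + 1)) → E →ᵇ E [×(i : ℕ)]→L[ℝ] ℂ))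

theorem JetSpace.norm_apply_le {N : ℕ} (b : JetSpace E N) (i : Fin (N + 1)) : ‖b i‖ ≤ ‖b‖ :=
  norm_le_pi_norm (f := (b : (i : Fin (N + 1)) → E →ᵇ E [×(i : ℕ)]→L[ℝ] ℂ)) i

/-- Evaluation of one of the components. -/
noncomputable def JetSpace.eval {N : ℕ} (i : Fin (N + 1)) (x : E) (m : Fin (i : ℕ) → E) :
    JetSpace E N →L[ℂ] ℂ :=
  LinearMap.mkContinuous
    { toFun := fun b => b i x m
      map_add' := fun _ _ => rfl
      map_smul' := fun _ _ => rfl } (∏ j, ‖m j‖) fun b => by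
    refine ((b i x).le_opNorm m).trans ?_
    rw [mul_comm]
    exact mul_le_mul_of_nonneg_left (((b i).norm_coe_le_norm x).trans (b.norm_apply_le i))
      (by positivity)

/-- The derivatives of order `≤ N`, as bounded continuous functions. -/
noncomputable def jet (N : ℕ) : BddSmooth E →ₗ[ℂ] JetSpace E N where
  toFun ψ i := BoundedContinuousFunction.ofNormedAddCommGroup
    (iteratedFDeriv ℝ (i : ℕ) (ψ : E → ℂ))
    (ψ.2.1.continuous_iteratedFDeriv (mod_cast le_top)) (ψ.2.2 i).choose (ψ.2.2 i).choose_spec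
  map_add' ψ φ := by
    refine funext fun i => BoundedContinuousFunction.ext fun x => ?_
    exact iteratedFDeriv_add_apply (ψ.2.1.of_le (mod_cast le_top)).contDiffAt
      (φ.2.1.of_le (mod_cast le_top)).contDiffAt
  map_smul' c ψ := by
    refine funext fun i => BoundedContinuousFunction.ext fun x => ?_
    exact iteratedFDeriv_const_smul_apply (ψ.2.1.of_le (mod_cast le_top)).contDiffAt

theorem jet_apply (N : ℕ) (ψ : BddSmooth E) (i : Fin (N + 1)) (x : E) :
    jet N ψ i x = iteratedFDeriv ℝ (i : ℕ) (ψ : E → ℂ) x := rfl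

theorem jet_injective (N : ℕ) : Function.Injective (jet (E := E) N) := by
  intro ψ φ h
  refine Subtype.ext (funext fun x => ?_)
  have h1 : iteratedFDeriv ℝ 0 (ψ : E → ℂ) x 0 = iteratedFDeriv ℝ 0 (φ : E → ℂ) x 0 :=
    congrArg (fun b : JetSpace E N => b 0 x 0) h
  simpa only [iteratedFDeriv_zero_apply] using h1

/-- A seminorm bound says exactly that `L` is continuous for the norm induced by the jet embedding,
so Hahn–Banach applies. The extension lives on a complete space, where vector-valued integrals are
available. -/
theorem exists_extension_jet {L : BddSmooth E →ₗ[ℂ] ℂ} {N : ℕ} {C : ℝ}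
    (hL : SeminormBound L N C) :
    ∃ T : JetSpace E N →L[ℂ] ℂ, ∀ ψ, T (jet N ψ) = L ψ := by
  let e := LinearEquiv.ofInjective (jet (E := E) N) (jet_injective N)
  let l : StrongDual ℂ (LinearMap.range (jet (E := E) N)) :=
    (L ∘ₗ e.symm.toLinearMap).mkContinuous C fun b => by
      obtain ⟨ψ, rfl⟩ := e.surjective b
      have h : (L ∘ₗ e.symm.toLinearMap) (e ψ) = L ψ := by simp
      rw [h]
      refine hL _ _ fun i hi x => ?_
      have h1 := (jet N ψ ⟨i, Nat.lt_succ_of_le hi⟩).norm_coe_le_norm x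
      exact h1.trans (JetSpace.norm_apply_le (jet N ψ) _)
  obtain ⟨T, hT, -⟩ := exists_extension_norm_eq _ l
  refine ⟨T, fun ψ => ?_⟩
  have h := hT (e ψ)
  have h2 : ((e ψ : LinearMap.range (jet (E := E) N)) : _) = jet N ψ := rfl
  rw [h2] at h
  rw [h]
  simp [l]

/-- Each component is Lipschitz in `y`, because the derivative of the next order is bounded. -/
theorem continuous_jet_translate (N : ℕ) (η : BddSmooth E) :
    Continuous fun y => jet N (translate η y) := by
  refine continuous_pi fun i => ?_
  obtain ⟨C, hC⟩ := η.2.2 (i + 1)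
  have hC0 : 0 ≤ C := (norm_nonneg _).trans (hC 0)
  refine LipschitzWith.continuous (K := C.toNNReal) (LipschitzWith.of_dist_le_mul fun y z => ?_)
  rw [Real.coe_toNNReal _ hC0]
  refine (BoundedContinuousFunction.dist_le (by positivity)).2 fun x => ?_
  rw [dist_eq_norm, jet_apply, jet_apply]
  simp only [translate]
  rw [iteratedFDeriv_comp_sub, iteratedFDeriv_comp_sub]
  refine (norm_iteratedFDeriv_sub_le_of_bound η.2.1 hC _ _).trans (le_of_eq ?_)
  rw [dist_eq_norm, ← norm_neg (y - z)]
  congr 2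
  abel

end Jet

/-! ### Interchanging a linear form with an integral. -/

section Exchange

open scoped BoundedContinuousFunction

variable {E : Type} [NormedAddCommGroup E] [NormedSpace ℝ E] [FiniteDimensional ℝ E]
  [MeasureSpace E] [BorelSpace E] [(volume : Measure E).IsAddHaarMeasure]

theorem integral_mul_smoothing {L : BddSmooth E →ₗ[ℂ] ℂ} {N : ℕ} {C : ℝ}
    (hL : SeminormBound L N C) (η : BddSmooth E) (hη : HasCompactSupport (η : E → ℂ))
    {φ : E → ℂ} (hφ : Continuous φ) (hφc : HasCompactSupport φ) (Ψ : BddSmooth E)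
    (hΨ : (Ψ : E → ℂ) = conv φ η) :
    ∫ y, φ y * smoothing L η y = L Ψ := by
  obtain ⟨T, hT⟩ := exists_extension_jet hL
  have hint : Integrable fun y => φ y • jet N (translate η y) :=
    (hφ.smul (continuous_jet_translate N η)).integrable_of_hasCompactSupport hφc.smul_right
  -- Equality of jets is tested by the continuous forms `JetSpace.eval`, which commute with the
  -- integral; what remains is differentiation of the convolution under the integral sign.
  have h1 : ∫ y, φ y • jet N (translate η y) = jet N Ψ := by
    refine funext fun i => BoundedContinuousFunction.ext fun x =>
      ContinuousMultilinearMap.ext fun m => ?_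
    have h2 := (JetSpace.eval i x m).integral_comp_comm hint
    refine Eq.trans (show _ = JetSpace.eval i x m (∫ y, φ y • jet N (translate η y)) from rfl) ?_
    rw [← h2, jet_apply, hΨ, iteratedFDeriv_conv_apply hφ.locallyIntegrable η.2.1 hη]
    refine integral_congr_ae (Eventually.of_forall fun y => ?_)
    change φ y * iteratedFDeriv ℝ (i : ℕ) (fun z => (η : E → ℂ) (z - y)) x m = _
    rw [iteratedFDeriv_comp_sub]
  rw [← hT, ← h1, ← T.integral_comp_comm hint]
  refine integral_congr_ae (Eventually.of_forall fun y => ?_)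
  simp [hT, smoothing]

end Exchange

/-! ### Finite order of distributions on compact sets. -/

section Distribution

variable {d : ℕ} {Ω : Opens (EuclideanSpace ℝ (Fin d))}

/-- The restriction of `T` to test functions supported in `K` is continuous for a topology given by
countably many seminorms, hence bounded by finitely many of them. -/
theorem Distr.exists_bound (T : Distr Ω) {K : Set (EuclideanSpace ℝ (Fin d))} (hK : IsCompact K)
    (hKΩ : K ⊆ Ω) : ∃ (N : ℕ) (C : ℝ), 0 ≤ C ∧ ∀ f : 𝓓(Ω, ℂ), (∀ x ∉ K, f x = 0) →
      ∀ M : ℝ, (∀ i ≤ N, ∀ x, ‖iteratedFDeriv ℝ i f x‖ ≤ M) → ‖T f‖ ≤ C * M := by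
  let K' : Compacts (EuclideanSpace ℝ (Fin d)) := ⟨K, hK⟩
  have hK' : (K' : Set (EuclideanSpace ℝ (Fin d))) ⊆ Ω := hKΩ
  let S : 𝓓_{K'}(EuclideanSpace ℝ (Fin d), ℂ) →L[ℂ] ℂ :=
    T.comp (TestFunction.ofSupportedInCLM ℂ hK')
  obtain ⟨s, C, -, hC⟩ := Seminorm.bound_of_continuous
    (ContDiffMapSupportedIn.withSeminorms ℂ (EuclideanSpace ℝ (Fin d)) ℂ ⊤ K')
    ((normSeminorm ℂ ℂ).comp S.toLinearMap) (continuous_norm.comp S.continuous)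
  refine ⟨s.sup id, C, C.2, fun f hf M hM => ?_⟩
  have hM0 : 0 ≤ M := (norm_nonneg _).trans (hM 0 (Nat.zero_le _) 0)
  let g : 𝓓_{K'}(EuclideanSpace ℝ (Fin d), ℂ) :=
    ContDiffMapSupportedIn.of_support_subset f.contDiff fun x hx => by
      by_contra h
      exact hx (hf x h)
  have hg : TestFunction.ofSupportedIn hK' g = f := by ext x; rfl
  have h1 := hC g
  have h2 : (s.sup (ContDiffMapSupportedIn.seminorm ℂ (EuclideanSpace ℝ (Fin d)) ℂ ⊤ K')) g ≤ M :=
    Seminorm.finset_sup_apply_le hM0 fun i hi =>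
      (ContDiffMapSupportedIn.seminorm_top_le_iff ℂ hM0 i g).2 fun x _ =>
        hM i (Finset.le_sup (f := id) hi) x
  have h3 : ‖T f‖ = ((normSeminorm ℂ ℂ).comp S.toLinearMap) g := by
    rw [← hg]; rfl
  rw [h3]
  refine h1.trans ?_
  exact mul_le_mul_of_nonneg_left h2 C.2

/-- The linear form `ψ ↦ ⟨T, κ ψ⟩`. -/
noncomputable def cutFunctional (κ : 𝓓(Ω, ℝ)) (T : Distr Ω) :
    BddSmooth (EuclideanSpace ℝ (Fin d)) →ₗ[ℂ] ℂ where
  toFun ψ := T (cutMul κ ψ ψ.2.1)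
  map_add' ψ φ := by
    rw [← map_add]
    congr 1
    ext x
    exact smul_add (κ x) ((ψ : EuclideanSpace ℝ (Fin d) → ℂ) x) _
  map_smul' c ψ := by
    rw [← map_smul]
    congr 1
    ext x
    exact smul_comm (κ x) c ((ψ : EuclideanSpace ℝ (Fin d) → ℂ) x)

theorem exists_seminormBound_cutFunctional (κ : 𝓓(Ω, ℝ)) (T : Distr Ω) :
    ∃ N C, SeminormBound (cutFunctional κ T) N C := by
  obtain ⟨N, C, hC, h⟩ := T.exists_bound κ.hasCompactSupport.isCompact κ.tsupport_subset
  choose B hB using (isBddSmooth_of_hasCompactSupport κ.contDiff κ.hasCompactSupport).2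
  refine ⟨N, C * ∑ i ∈ Finset.range (N + 1), ∑ j ∈ Finset.range (i + 1), (i.choose j : ℝ) * B j,
    fun ψ M hM => ?_⟩
  rw [mul_assoc]
  have hM0 : 0 ≤ M := (norm_nonneg _).trans (hM 0 (Nat.zero_le _) 0)
  have hB0 : ∀ j, 0 ≤ B j := fun j => (norm_nonneg _).trans (hB j 0)
  refine h (cutMul κ ψ ψ.2.1) (fun x hx => ?_) _ fun i hi x => ?_
  · change κ x • (ψ : EuclideanSpace ℝ (Fin d) → ℂ) x = _
    rw [image_eq_zero_of_notMem_tsupport hx, zero_smul]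
  · change ‖iteratedFDeriv ℝ i (fun x => κ x • (ψ : EuclideanSpace ℝ (Fin d) → ℂ) x) x‖ ≤ _
    refine (norm_iteratedFDeriv_smul_le (n := i) (N := ∞) κ.contDiff ψ.2.1 x
      (mod_cast le_top)).trans ?_
    refine le_trans ?_ (mul_le_mul_of_nonneg_right (Finset.single_le_sum
      (f := fun i => ∑ j ∈ Finset.range (i + 1), (i.choose j : ℝ) * B j)
      (fun i _ => Finset.sum_nonneg fun j _ => mul_nonneg (Nat.cast_nonneg _) (hB0 j))
      (Finset.mem_range.2 (Nat.lt_succ_of_le hi))) hM0)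
    rw [Finset.sum_mul]
    refine Finset.sum_le_sum fun j hj => ?_
    exact mul_le_mul (mul_le_mul_of_nonneg_left (hB j x) (Nat.cast_nonneg _))
      (hM _ ((Nat.sub_le _ _).trans hi) x) (norm_nonneg _)
      (mul_nonneg (Nat.cast_nonneg _) (hB0 j))

end Distribution

/-! ### Taylor expansion along a line. -/

section Taylor

open scoped Nat

variable {E : Type} [NormedAddCommGroup E] [NormedSpace ℝ E]

theorem iteratedDeriv_comp_line {u : E → ℂ} (hu : ContDiff ℝ ∞ u) (y v : E) (k : ℕ) (t : ℝ) :
    iteratedDeriv k (fun s : ℝ => u (y + s • v)) t =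
      iteratedFDeriv ℝ k u (y + t • v) fun _ => v := by
  let g : ℝ →L[ℝ] E := ContinuousLinearMap.toSpanSingleton ℝ v
  have hw : ContDiff ℝ ∞ fun z => u (y + z) := hu.comp (contDiff_const.add contDiff_id)
  have h := g.iteratedFDeriv_comp_right hw t (i := k) (mod_cast le_top)
  have h2 : (fun s : ℝ => u (y + s • v)) = (fun z => u (y + z)) ∘ g := by
    funext s
    simp [g]
  rw [iteratedDeriv, h2, h, iteratedFDeriv_comp_add_left]
  simp [g]

theorem norm_sub_taylor_le {u : E → ℂ} (hu : ContDiff ℝ ∞ u) {n : ℕ} {A : ℝ}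
    (hA : ∀ x, ‖iteratedFDeriv ℝ (n + 1) u x‖ ≤ A) (y v : E) :
    ‖u (y + v) - ∑ k ∈ Finset.range (n + 1), (k ! : ℝ)⁻¹ • iteratedFDeriv ℝ k u y fun _ => v‖ ≤
      A * ‖v‖ ^ (n + 1) := by
  have hA0 : 0 ≤ A := (norm_nonneg _).trans (hA 0)
  have hg : ContDiff ℝ ∞ fun s : ℝ => u (y + s • v) := by fun_prop
  have hd : ∀ k : ℕ, ∀ t ∈ Set.Icc (0 : ℝ) 1,
      iteratedDerivWithin k (fun s : ℝ => u (y + s • v)) (Set.Icc 0 1) t =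
        iteratedFDeriv ℝ k u (y + t • v) fun _ => v := fun k t ht => by
    rw [iteratedDerivWithin_eq_iteratedDeriv (uniqueDiffOn_Icc one_pos)
      (hg.of_le (mod_cast le_top)).contDiffAt ht, iteratedDeriv_comp_line hu]
  have h := taylor_mean_remainder_bound (f := fun s : ℝ => u (y + s • v)) (n := n) (x := 1)
    (C := A * ‖v‖ ^ (n + 1)) zero_le_one (hg.of_le (by exact_mod_cast le_top)).contDiffOn
    (Set.right_mem_Icc.2 zero_le_one) fun t ht => by
      rw [hd _ t ht]
      refine (ContinuousMultilinearMap.le_opNorm _ _).trans ?_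
      simpa using mul_le_mul_of_nonneg_right (hA (y + t • v)) (by positivity)
  rw [taylor_within_apply] at h
  have hs : ∑ k ∈ Finset.range (n + 1), ((k ! : ℝ)⁻¹ * (1 - 0) ^ k) •
      iteratedDerivWithin k (fun s : ℝ => u (y + s • v)) (Set.Icc 0 1) 0 =
      ∑ k ∈ Finset.range (n + 1), (k ! : ℝ)⁻¹ • iteratedFDeriv ℝ k u y fun _ => v := by
    refine Finset.sum_congr rfl fun k _ => ?_
    rw [hd k 0 (Set.left_mem_Icc.2 zero_le_one)]
    simp
  rw [hs] at h
  have h1 : ‖u (y + (1 : ℝ) • v) -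
      ∑ k ∈ Finset.range (n + 1), (k ! : ℝ)⁻¹ • iteratedFDeriv ℝ k u y fun _ => v‖ ≤
      A * ‖v‖ ^ (n + 1) := by
    refine h.trans (div_le_of_le_mul₀ (by positivity) (by positivity) ?_)
    rw [sub_zero, one_pow, mul_one]
    exact le_mul_of_one_le_right (by positivity)
      (by exact_mod_cast Nat.one_le_iff_ne_zero.2 (Nat.factorial_ne_zero n))
  simpa using h1

end Taylor

/-! ### Vanishing moments against multilinear forms. -/

section Moments

variable {d : ℕ} (ρ : 𝓢(EuclideanSpace ℝ (Fin d), ℂ))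

theorem integrable_schwartz_mul_multilinear {k : ℕ}
    (M : EuclideanSpace ℝ (Fin d) [×k]→L[ℝ] ℂ) :
    Integrable fun z : EuclideanSpace ℝ (Fin d) => ρ z * M fun _ => z := by
  refine ((ρ.integrable_pow_mul volume k).const_mul ‖M‖).mono'
    (ρ.continuous.mul (M.cont.comp (continuous_pi fun _ => continuous_id))).aestronglyMeasurable
    (Eventually.of_forall fun z => ?_)
  rw [norm_mul]
  refine (mul_le_mul_of_nonneg_left (M.le_opNorm _) (norm_nonneg _)).trans (le_of_eq ?_)
  simp only [Finset.prod_const, Finset.card_univ, Fintype.card_fin]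
  ring

/-- Grouping the basis indices `r j` by value turns a form on the diagonal into monomials, the shape
in which the moment conditions are given. -/
theorem multilinear_diag_eq_sum {k : ℕ} (M : EuclideanSpace ℝ (Fin d) [×k]→L[ℝ] ℂ)
    (z : EuclideanSpace ℝ (Fin d)) :
    (M fun _ => z) = ∑ r : Fin k → Fin d,
      (∏ i, ((z i : ℝ) : ℂ) ^ (Finset.univ.filter fun j => r j = i).card) *
        M fun j => EuclideanSpace.single (r j) 1 := by
  have hz : z = ∑ i, z i • EuclideanSpace.single i (1 : ℝ) := by
    simpa using ((EuclideanSpace.basisFun (Fin d) ℝ).sum_repr z).symm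
  have h : (M fun _ => z) = M fun _ => ∑ i, z i • EuclideanSpace.single i (1 : ℝ) := by
    rw [← hz]
  rw [h, ContinuousMultilinearMap.map_sum]
  refine Finset.sum_congr rfl fun r _ => ?_
  rw [ContinuousMultilinearMap.map_smul_univ, Complex.real_smul, Complex.ofReal_prod,
    ← Finset.prod_fiberwise' Finset.univ r fun i => ((z i : ℝ) : ℂ)]
  simp only [Finset.prod_const]

variable {ρ}

theorem integral_schwartz_mul_multilinear_eq_zero
    (hρ_mom : ∀ m : Fin d → ℕ, m ≠ 0 → ∫ x, (∏ i, ((x i : ℝ) : ℂ) ^ m i) * ρ x = 0)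
    {k : ℕ} (hk : k ≠ 0) (M : EuclideanSpace ℝ (Fin d) [×k]→L[ℝ] ℂ) :
    ∫ z : EuclideanSpace ℝ (Fin d), ρ z * (M fun _ => z) = 0 := by
  have hint : ∀ m : Fin d → ℕ, Integrable fun x : EuclideanSpace ℝ (Fin d) =>
      (∏ i, ((x i : ℝ) : ℂ) ^ m i) * ρ x := fun m => by
    refine (ρ.integrable_pow_mul volume (∑ i, m i)).mono'
      (Continuous.aestronglyMeasurable (by fun_prop)) (Eventually.of_forall fun x => ?_)
    rw [norm_mul, norm_prod, ← Finset.prod_pow_eq_pow_sum]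
    refine mul_le_mul_of_nonneg_right (Finset.prod_le_prod (fun _ _ => norm_nonneg _)
      fun i _ => ?_) (norm_nonneg _)
    rw [norm_pow, Complex.norm_real]
    exact pow_le_pow_left₀ (norm_nonneg _) (PiLp.norm_apply_le x i) _
  simp only [multilinear_diag_eq_sum M, Finset.mul_sum]
  rw [integral_finsetSum _ fun r _ => ?_]
  · refine Finset.sum_eq_zero fun r _ => ?_
    have h : ∀ x : EuclideanSpace ℝ (Fin d), ρ x *
        ((∏ i, ((x i : ℝ) : ℂ) ^ (Finset.univ.filter fun j => r j = i).card) *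
          M fun j => EuclideanSpace.single (r j) 1) =
        ((∏ i, ((x i : ℝ) : ℂ) ^ (Finset.univ.filter fun j => r j = i).card) * ρ x) *
          M fun j => EuclideanSpace.single (r j) 1 := fun x => by ring
    simp only [h]
    rw [integral_mul_const, hρ_mom _ fun h0 => ?_, zero_mul]
    -- The multi-index of `r` is nonzero: it counts at least one occurrence of the value `r 0`.
    have h1 := congrFun h0 (r ⟨0, Nat.pos_of_ne_zero hk⟩)
    simp only [Pi.zero_apply, Finset.card_eq_zero] at h1
    exact (Finset.notMem_empty (⟨0, Nat.pos_of_ne_zero hk⟩ : Fin k)) (h1 ▸ by simp)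
  · have h : (fun x : EuclideanSpace ℝ (Fin d) => ρ x *
        ((∏ i, ((x i : ℝ) : ℂ) ^ (Finset.univ.filter fun j => r j = i).card) *
          M fun j => EuclideanSpace.single (r j) 1)) = fun x =>
        ((∏ i, ((x i : ℝ) : ℂ) ^ (Finset.univ.filter fun j => r j = i).card) * ρ x) *
          M fun j => EuclideanSpace.single (r j) 1 := funext fun x => by ring
    rw [h]
    exact (hint _).mul_const _

end Moments

/-! ### Quantitative approximation by the truncated mollifiers. -/

section Approximation

open scoped Nat

variable {d : ℕ} {ρ : 𝓢(EuclideanSpace ℝ (Fin d), ℂ)}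
  {χ : 𝓓((⊤ : Opens (EuclideanSpace ℝ (Fin d))), ℝ)}

theorem abs_log_mul_self_sq_le {ε : ℝ} (h0 : 0 < ε) (h1 : ε ≤ 1) :
    (|Real.log ε| * ε) ^ 2 ≤ 4 * ε := by
  have h := (Real.abs_log_mul_self_rpow_lt ε (1 / 2) h0 h1 (by norm_num)).le
  rw [abs_mul, abs_of_nonneg (Real.rpow_nonneg h0.le _), ← Real.sqrt_eq_rpow] at h
  have h2 : (|Real.log ε| * ε) ^ 2 = (|Real.log ε| * √ε) ^ 2 * ε := by
    rw [mul_pow, mul_pow, Real.sq_sqrt h0.le]; ring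
  rw [h2]
  refine mul_le_mul_of_nonneg_right ?_ h0.le
  have h3 : |Real.log ε| * √ε ≤ 2 := h.trans (by norm_num)
  have h4 := pow_le_pow_left₀ (by positivity) h3 2
  norm_num at h4 ⊢
  exact h4

theorem conv_theta_eq {ε : Set.Ioc (0 : ℝ) 1} (hε : (ε : ℝ) ≠ 1)
    (u : EuclideanSpace ℝ (Fin d) → ℂ) (y : EuclideanSpace ℝ (Fin d)) :
    conv (theta ρ χ ε) u y = ∫ z, ρ z * ((χ ((|Real.log ε| * ε) • z) : ℝ) : ℂ) *
      u (y - (ε : ℝ) • z) := by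
  have h0 : (0 : ℝ) < ε := ε.2.1
  have h := Measure.integral_comp_smul_of_nonneg volume
    (fun t => theta ρ χ ε t * u (y - t)) (ε : ℝ) (hR := h0.le)
  rw [finrank_euclideanSpace_fin, ← inv_smul_eq_iff₀ (by positivity), inv_inv] at h
  rw [conv, ← h, ← integral_smul]
  refine integral_congr_ae (Eventually.of_forall fun z => ?_)
  simp only [theta, hε, if_false, smul_smul, inv_mul_cancel₀ h0.ne', one_smul]
  rw [Complex.real_smul]
  have h2 : ((((ε : ℝ) ^ d : ℝ)) : ℂ) ≠ 0 := by exact_mod_cast (pow_pos h0 d).ne'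
  rw [Complex.ofReal_inv]
  field_simp

/-- The expansion goes to order `2 * N + 1`, twice what `ε ^ (N + 1)` would suggest, because the
truncation by `χ` is controlled only by powers of `δ = |ln ε| ε`, and `δ²` is bounded by `4 ε`. The
bound is linear in `A` and uniform in `u`, so that it can later be applied to all derivatives of a
function. -/
theorem exists_norm_conv_theta_sub_le (hρ_int : ∫ x, ρ x = 1)
    (hρ_mom : ∀ m : Fin d → ℕ, m ≠ 0 → ∫ x, (∏ i, ((x i : ℝ) : ℂ) ^ m i) * ρ x = 0)
    (hχ_range : ∀ x, 0 ≤ χ x ∧ χ x ≤ 1) (hχ_one : ∀ x, ‖x‖ ≤ 1 → χ x = 1) (N : ℕ) :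
    ∃ C : ℝ, 0 ≤ C ∧ ∀ ε : Set.Ioc (0 : ℝ) 1, (ε : ℝ) ≠ 1 →
      ∀ u : EuclideanSpace ℝ (Fin d) → ℂ, ContDiff ℝ ∞ u → ∀ A : ℝ, (∀ x, ‖u x‖ ≤ A) →
        (∀ x, ‖iteratedFDeriv ℝ (2 * N + 1 + 1) u x‖ ≤ A) →
          ∀ y, ‖conv (theta ρ χ ε) u y - u y‖ ≤ C * A * (ε : ℝ) ^ (N + 1) := by
  -- The summand `4 ^ (N + 1)` pays for the truncation, the summand `1` for the Taylor remainder.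
  refine ⟨(4 ^ (N + 1) + 1) * ∫ z, ‖z‖ ^ (2 * N + 1 + 1) * ‖ρ z‖, by positivity,
    fun ε hε u hu A hA0 hA y => ?_⟩
  have h0 : (0 : ℝ) < ε := ε.2.1
  have h1 : (ε : ℝ) ≤ 1 := ε.2.2
  have hApos : 0 ≤ A := (norm_nonneg _).trans (hA0 0)
  set δ : ℝ := |Real.log ε| * ε with hδ
  have hδ0 : 0 ≤ δ := by positivity
  let P : EuclideanSpace ℝ (Fin d) → ℂ := fun z => ∑ k ∈ Finset.range (2 * N + 1 + 1),
    (k ! : ℝ)⁻¹ • iteratedFDeriv ℝ k u y fun _ => -((ε : ℝ) • z)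
  have hP : ∀ z, ρ z * P z = ∑ k ∈ Finset.range (2 * N + 1 + 1),
      (((k ! : ℝ)⁻¹ * (-(ε : ℝ)) ^ k : ℝ) : ℂ) * (ρ z * iteratedFDeriv ℝ k u y fun _ => z) := by
    intro z
    simp only [P, Finset.mul_sum]
    refine Finset.sum_congr rfl fun k _ => ?_
    have h2 : (iteratedFDeriv ℝ k u y fun _ => -((ε : ℝ) • z)) =
        ((-(ε : ℝ)) ^ k) • iteratedFDeriv ℝ k u y fun _ => z := by
      have := (iteratedFDeriv ℝ k u y).map_smul_univ (fun _ => -(ε : ℝ)) fun _ => z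
      simpa using this
    rw [h2, Complex.real_smul, Complex.real_smul, Complex.ofReal_mul]
    ring
  have hPint : Integrable fun z => ρ z * P z := by
    simp only [hP]
    exact integrable_finsetSum _ fun k _ =>
      (integrable_schwartz_mul_multilinear ρ (iteratedFDeriv ℝ k u y)).const_mul _
  have hPval : ∫ z, ρ z * P z = u y := by
    simp only [hP]
    rw [integral_finsetSum _ fun k _ =>
      (integrable_schwartz_mul_multilinear ρ (iteratedFDeriv ℝ k u y)).const_mul _,
      Finset.sum_eq_single 0]
    · simp [integral_mul_const, hρ_int]
    · intro k _ hk
      rw [integral_const_mul, integral_schwartz_mul_multilinear_eq_zero hρ_mom hk, mul_zero]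
    · simp
  have hχn : ∀ x, ‖((χ x : ℝ) : ℂ)‖ ≤ 1 := fun x => by
    rw [Complex.norm_real, Real.norm_of_nonneg (hχ_range x).1]
    exact (hχ_range x).2
  have hint : Integrable fun z => ρ z * ((χ (δ • z) : ℝ) : ℂ) * u (y - (ε : ℝ) • z) := by
    have hc := hu.continuous
    refine (ρ.integrable.norm.const_mul A).mono'
      (Continuous.aestronglyMeasurable (by fun_prop)) (Eventually.of_forall fun z => ?_)
    rw [norm_mul, norm_mul, mul_comm A]
    refine mul_le_mul ?_ (hA0 _) (norm_nonneg _) (norm_nonneg _)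
    exact mul_le_of_le_one_right (norm_nonneg _) (hχn _)
  rw [conv_theta_eq hε, ← hPval, ← integral_sub hint hPint]
  have hbound : ∀ z, ‖ρ z * ((χ (δ • z) : ℝ) : ℂ) * u (y - (ε : ℝ) • z) - ρ z * P z‖ ≤
      (4 ^ (N + 1) + 1) * A * (ε : ℝ) ^ (N + 1) * (‖z‖ ^ (2 * N + 1 + 1) * ‖ρ z‖) := by
    intro z
    have e1 : ρ z * ((χ (δ • z) : ℝ) : ℂ) * u (y - (ε : ℝ) • z) - ρ z * P z =
        ρ z * ((((χ (δ • z) : ℝ) : ℂ) - 1) * u (y - (ε : ℝ) • z) +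
          (u (y - (ε : ℝ) • z) - P z)) := by ring
    -- The left side vanishes where `δ ‖z‖ ≤ 1` and is at most `1` elsewhere, so any power of `δ
    -- ‖z‖` dominates it; the growth in `z` is absorbed by `ρ`.
    have e2 : ‖((χ (δ • z) : ℝ) : ℂ) - 1‖ ≤ (δ * ‖z‖) ^ (2 * N + 1 + 1) := by
      by_cases h : ‖δ • z‖ ≤ 1
      · rw [hχ_one _ h]
        simp only [Complex.ofReal_one, sub_self, norm_zero]
        positivity
      · have h3 : ‖((χ (δ • z) : ℝ) : ℂ) - 1‖ ≤ 1 := by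
          rw [← Complex.ofReal_one, ← Complex.ofReal_sub, Complex.norm_real, Real.norm_eq_abs,
            abs_le]
          exact ⟨by linarith [(hχ_range (δ • z)).1], by linarith [(hχ_range (δ • z)).2]⟩
        refine h3.trans (one_le_pow₀ ?_)
        rw [norm_smul, Real.norm_of_nonneg hδ0] at h
        exact (not_le.1 h).le
    have e3 : ‖u (y - (ε : ℝ) • z) - P z‖ ≤ A * ((ε : ℝ) * ‖z‖) ^ (2 * N + 1 + 1) := by
      have := norm_sub_taylor_le hu hA y (-((ε : ℝ) • z))
      rwa [norm_neg, norm_smul, Real.norm_of_nonneg h0.le, ← sub_eq_add_neg] at this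
    have e4 : δ ^ (2 * N + 1 + 1) ≤ 4 ^ (N + 1) * (ε : ℝ) ^ (N + 1) := by
      rw [show 2 * N + 1 + 1 = 2 * (N + 1) by ring, pow_mul, ← mul_pow]
      exact pow_le_pow_left₀ (by positivity) (abs_log_mul_self_sq_le h0 h1) _
    have e5 : (ε : ℝ) ^ (2 * N + 1 + 1) ≤ (ε : ℝ) ^ (N + 1) :=
      pow_le_pow_of_le_one h0.le h1 (by omega)
    rw [e1, norm_mul]
    have e6 : ‖(((χ (δ • z) : ℝ) : ℂ) - 1) * u (y - (ε : ℝ) • z) + (u (y - (ε : ℝ) • z) - P z)‖ ≤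
        (δ * ‖z‖) ^ (2 * N + 1 + 1) * A + A * ((ε : ℝ) * ‖z‖) ^ (2 * N + 1 + 1) := by
      refine (norm_add_le _ _).trans (add_le_add ?_ e3)
      rw [norm_mul]
      exact mul_le_mul e2 (hA0 _) (norm_nonneg _) (by positivity)
    refine (mul_le_mul_of_nonneg_left e6 (norm_nonneg _)).trans ?_
    rw [mul_pow δ, mul_pow (ε : ℝ)]
    have e7 : δ ^ (2 * N + 1 + 1) + (ε : ℝ) ^ (2 * N + 1 + 1) ≤
        (4 ^ (N + 1) + 1) * (ε : ℝ) ^ (N + 1) := by linarith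
    have e8 := mul_le_mul_of_nonneg_left e7
      (show 0 ≤ A * (‖z‖ ^ (2 * N + 1 + 1) * ‖ρ z‖) by positivity)
    linarith
  refine (norm_integral_le_of_norm_le ((ρ.integrable_pow_mul volume _).const_mul _)
    (Eventually.of_forall hbound)).trans (le_of_eq ?_)
  rw [integral_const_mul]
  ring

end Approximation

/-! ### Size and support of the mollifiers, and localization. -/

section Theta

variable {d : ℕ} (ρ : 𝓢(EuclideanSpace ℝ (Fin d), ℂ))
  (χ : 𝓓((⊤ : Opens (EuclideanSpace ℝ (Fin d))), ℝ))

theorem tendsto_val_atZero : Tendsto (Subtype.val : Set.Ioc (0 : ℝ) 1 → ℝ) atZero (𝓝[>] 0) :=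
  tendsto_nhdsWithin_iff.2 ⟨tendsto_comap, Eventually.of_forall fun ε => ε.2.1⟩

theorem abs_log_le_inv {ε : ℝ} (h0 : 0 < ε) (h1 : ε ≤ 1) : |Real.log ε| ≤ ε⁻¹ := by
  rw [abs_of_nonpos (Real.log_nonpos h0.le h1), ← Real.log_inv]
  exact (Real.log_le_sub_one_of_pos (inv_pos.2 h0)).trans (by linarith)

/-- By the Leibniz rule: a derivative on `ρ` costs `ε⁻¹`, one on `χ` costs `|ln ε| ≤ ε⁻¹`. -/
theorem exists_norm_iteratedFDeriv_theta_le (k : ℕ) :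
    ∃ C : ℝ, 0 ≤ C ∧ ∀ ε : Set.Ioc (0 : ℝ) 1, (ε : ℝ) ≠ 1 → ∀ x,
      ‖iteratedFDeriv ℝ k (theta ρ χ ε) x‖ ≤ C * ((ε : ℝ) ^ (d + k))⁻¹ := by
  have hχ : IsBddSmooth fun x : EuclideanSpace ℝ (Fin d) => ((χ x : ℝ) : ℂ) :=
    isBddSmooth_of_hasCompactSupport (Complex.ofRealCLM.contDiff.comp χ.contDiff)
      (χ.hasCompactSupport.comp_left (g := fun t : ℝ => (t : ℂ)) Complex.ofReal_zero)
  choose B hB using hχ.2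
  have hA := fun j x => ρ.norm_iteratedFDeriv_le_seminorm ℝ j x
  set A : ℕ → ℝ := fun j => SchwartzMap.seminorm ℝ 0 j ρ
  have hA0 : ∀ j, 0 ≤ A j := fun j => (norm_nonneg _).trans (hA j 0)
  have hB0 : ∀ j, 0 ≤ B j := fun j => (norm_nonneg _).trans (hB j 0)
  refine ⟨∑ j ∈ Finset.range (k + 1), (k.choose j : ℝ) * A j * B (k - j),
    Finset.sum_nonneg fun j _ => mul_nonneg (mul_nonneg (Nat.cast_nonneg _) (hA0 _)) (hB0 _),
    fun ε hε x => ?_⟩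
  have h0 : (0 : ℝ) < ε := ε.2.1
  let f : EuclideanSpace ℝ (Fin d) → ℂ := fun x => ρ ((ε : ℝ)⁻¹ • x)
  let g : EuclideanSpace ℝ (Fin d) → ℂ := fun x => ((χ (|Real.log ε| • x) : ℝ) : ℂ)
  have hf : ContDiff ℝ ∞ f := (ρ.smooth ⊤).comp (contDiff_const_smul _)
  have hg : ContDiff ℝ ∞ g := hχ.1.comp (contDiff_const_smul _)
  have hfj : ∀ j, ‖iteratedFDeriv ℝ j f x‖ ≤ ((ε : ℝ)⁻¹) ^ j * A j := fun j => by
    rw [iteratedFDeriv_comp_const_smul _ ((ρ.smooth ⊤).of_le (mod_cast le_top)), norm_smul,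
      norm_pow, Real.norm_of_nonneg (inv_nonneg.2 h0.le)]
    exact mul_le_mul_of_nonneg_left (hA j _) (by positivity)
  have hgj : ∀ j, ‖iteratedFDeriv ℝ j g x‖ ≤ ((ε : ℝ)⁻¹) ^ j * B j := fun j => by
    have := iteratedFDeriv_comp_const_smul (i := j) |Real.log ε| (hχ.1.of_le (mod_cast le_top))
    rw [show iteratedFDeriv ℝ j g = _ from this, norm_smul, norm_pow, Real.norm_eq_abs, abs_abs]
    exact mul_le_mul (pow_le_pow_left₀ (abs_nonneg _) (abs_log_le_inv h0 ε.2.2) _) (hB j _)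
      (norm_nonneg _) (by positivity)
  have hθ : theta ρ χ ε = ((((ε : ℝ) ^ d)⁻¹ : ℝ) : ℂ) • fun x => f x * g x := by
    funext x
    simp only [theta, hε, if_false, Pi.smul_apply, smul_eq_mul, f, g, mul_assoc]
  rw [hθ, iteratedFDeriv_const_smul_apply ((hf.mul hg).of_le (mod_cast le_top)).contDiffAt,
    norm_smul, Complex.norm_real, Real.norm_of_nonneg (by positivity), pow_add, mul_inv, mul_comm,
    mul_comm ((ε : ℝ) ^ d)⁻¹, ← mul_assoc]
  refine mul_le_mul_of_nonneg_right ?_ (by positivity)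
  refine (norm_iteratedFDeriv_mul_le (n := k) (N := ∞) hf hg x (mod_cast le_top)).trans ?_
  rw [Finset.sum_mul]
  refine Finset.sum_le_sum fun j hj => ?_
  have hj' : j ≤ k := Nat.lt_succ_iff.1 (Finset.mem_range.1 hj)
  have h1 : ((ε : ℝ) ^ k)⁻¹ = ((ε : ℝ)⁻¹) ^ j * ((ε : ℝ)⁻¹) ^ (k - j) := by
    rw [← pow_add, Nat.add_sub_cancel' hj', inv_pow]
  rw [h1]
  calc _ ≤ (k.choose j : ℝ) * (((ε : ℝ)⁻¹) ^ j * A j) * (((ε : ℝ)⁻¹) ^ (k - j) * B (k - j)) :=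
        mul_le_mul (mul_le_mul_of_nonneg_left (hfj j) (Nat.cast_nonneg _)) (hgj _) (norm_nonneg _)
          (mul_nonneg (Nat.cast_nonneg _) (mul_nonneg (by positivity) (hA0 _)))
    _ = _ := by ring

variable {χ}

theorem abs_log_mul_norm_lt_of_theta_ne_zero (hχ_zero : ∀ x, 2 ≤ ‖x‖ → χ x = 0)
    {ε : Set.Ioc (0 : ℝ) 1} (hε : (ε : ℝ) ≠ 1) {x : EuclideanSpace ℝ (Fin d)}
    (hx : theta ρ χ ε x ≠ 0) : |Real.log ε| * ‖x‖ < 2 := by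
  by_contra h
  refine hx ?_
  rw [theta, if_neg hε, hχ_zero, Complex.ofReal_zero, mul_zero]
  rw [norm_smul, Real.norm_eq_abs, abs_abs]
  exact not_lt.1 h

theorem hasCompactSupport_theta (hχ_zero : ∀ x, 2 ≤ ‖x‖ → χ x = 0)
    {ε : Set.Ioc (0 : ℝ) 1} (hε : (ε : ℝ) ≠ 1) : HasCompactSupport (theta ρ χ ε) := by
  have hl : 0 < |Real.log ε| :=
    abs_pos.2 (Real.log_neg ε.2.1 (lt_of_le_of_ne ε.2.2 hε)).ne
  refine HasCompactSupport.intro (isCompact_closedBall 0 (2 / |Real.log ε|)) fun x hx => ?_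
  by_contra h
  refine hx ?_
  rw [mem_closedBall_zero_iff, le_div_iff₀ hl, mul_comm]
  exact (abs_log_mul_norm_lt_of_theta_ne_zero ρ hχ_zero hε h).le

theorem isBddSmooth_theta (hχ_zero : ∀ x, 2 ≤ ‖x‖ → χ x = 0) (ε : Set.Ioc (0 : ℝ) 1) :
    IsBddSmooth (theta ρ χ ε) := by
  by_cases hε : (ε : ℝ) = 1
  · have : theta ρ χ ε = fun _ => 1 := by
      funext x
      rw [theta, if_pos hε]
    rw [this]
    exact isBddSmooth_const 1
  · exact isBddSmooth_of_hasCompactSupport (contDiff_theta ρ χ ε)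
      (hasCompactSupport_theta ρ hχ_zero hε)

theorem eventually_norm_le_of_theta_ne_zero (hχ_zero : ∀ x, 2 ≤ ‖x‖ → χ x = 0) {r : ℝ}
    (hr : 0 < r) :
    ∀ᶠ ε : Set.Ioc (0 : ℝ) 1 in atZero, (ε : ℝ) ≠ 1 ∧ ∀ x, theta ρ χ ε x ≠ 0 → ‖x‖ ≤ r := by
  have h1 : ∀ᶠ ε : Set.Ioc (0 : ℝ) 1 in atZero, Real.log (ε : ℝ) < -(2 / r) :=
    (Real.tendsto_log_nhdsGT_zero.comp tendsto_val_atZero).eventually_lt_atBot _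
  filter_upwards [h1] with ε hε
  have h2 : (0 : ℝ) < 2 / r := by positivity
  have hne : (ε : ℝ) ≠ 1 := fun h => by
    rw [h, Real.log_one] at hε
    linarith
  refine ⟨hne, fun x hx => ?_⟩
  have h3 := abs_log_mul_norm_lt_of_theta_ne_zero ρ hχ_zero hne hx
  by_contra h
  have h4 : 2 / r < |Real.log ε| := (lt_neg.1 hε).trans_le (neg_le_abs _)
  have h5 := mul_lt_mul'' h4 (not_le.1 h) h2.le hr.le
  rw [div_mul_cancel₀ _ hr.ne'] at h5
  linarith

theorem eventually_subset_exhaustion {Ω : Opens (EuclideanSpace ℝ (Fin d))}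
    {K : Set (EuclideanSpace ℝ (Fin d))} (hK : IsCompact K) (hKΩ : K ⊆ Ω) :
    ∀ᶠ ε : Set.Ioc (0 : ℝ) 1 in atZero, K ⊆ exhaustion Ω (ε : ℝ) := by
  obtain ⟨r, hr, hrΩ⟩ := hK.exists_thickening_subset_open Ω.isOpen hKΩ
  obtain ⟨R, hR⟩ := hK.isBounded.exists_norm_le
  have h1 : ∀ᶠ ε : Set.Ioc (0 : ℝ) 1 in atZero, (ε : ℝ) < r :=
    (tendsto_val_atZero.mono_right nhdsWithin_le_nhds).eventually_lt_const hr
  have h2 : ∀ᶠ ε : Set.Ioc (0 : ℝ) 1 in atZero, R ≤ (ε : ℝ)⁻¹ :=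
    (tendsto_inv_nhdsGT_zero.comp tendsto_val_atZero).eventually_ge_atTop R
  filter_upwards [h1, h2] with ε hε1 hε2 x hx
  refine ⟨hKΩ hx, ?_, by rw [one_div]; exact (hR x hx).trans hε2⟩
  refine Metric.le_infEDist.2 fun z hz => ?_
  by_contra h
  refine hz (hrΩ (Metric.mem_thickening_iff.2 ⟨x, hx, ?_⟩))
  rw [not_le, edist_dist, ENNReal.ofReal_lt_ofReal_iff ε.2.1, dist_comm] at h
  exact h.trans hε1

/-- Points `y` range over an open `U ⊇ K`, not just `K`, so that identities between functions of `y`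
can be differentiated at points of `K`. -/
theorem exists_localization {Ω : Opens (EuclideanSpace ℝ (Fin d))}
    (hχ_zero : ∀ x, 2 ≤ ‖x‖ → χ x = 0) {κ : Set.Ioc (0 : ℝ) 1 → 𝓓(Ω, ℝ)}
    (hκ_one : ∀ ε : Set.Ioc (0 : ℝ) 1, ∀ x ∈ exhaustion Ω (ε : ℝ), κ ε x = 1)
    {K : Set (EuclideanSpace ℝ (Fin d))} (hK : IsCompact K) (hKΩ : K ⊆ Ω) :
    ∃ K' U : Set (EuclideanSpace ℝ (Fin d)), IsCompact K' ∧ K' ⊆ Ω ∧ IsOpen U ∧ K ⊆ U ∧ U ⊆ K' ∧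
      ∀ᶠ ε : Set.Ioc (0 : ℝ) 1 in atZero, (ε : ℝ) ≠ 1 ∧ (∀ x ∈ K', κ ε x = 1) ∧
        ∀ y ∈ U, ∀ x, theta ρ χ ε (y - x) ≠ 0 → x ∈ K' := by
  obtain ⟨r, hr, hrΩ⟩ := hK.exists_cthickening_subset_open Ω.isOpen hKΩ
  have hr2 : 0 < r / 2 := half_pos hr
  refine ⟨Metric.cthickening r K, Metric.thickening (r / 2) K, hK.cthickening, hrΩ,
    Metric.isOpen_thickening, Metric.self_subset_thickening hr2 K,
    (Metric.thickening_subset_cthickening _ _).trans (Metric.cthickening_mono (by linarith) K), ?_⟩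
  filter_upwards [eventually_norm_le_of_theta_ne_zero ρ hχ_zero hr2,
    eventually_subset_exhaustion hK.cthickening hrΩ] with ε h1 h2
  refine ⟨h1.1, fun x hx => hκ_one ε x (h2 hx), fun y hy x hx => ?_⟩
  obtain ⟨z, hz, hyz⟩ := Metric.mem_thickening_iff.1 hy
  refine Metric.mem_cthickening_of_dist_le x z r K hz ?_
  have h3 := h1.2 _ hx
  rw [← dist_eq_norm, dist_comm] at h3
  linarith [dist_triangle x y z]

end Theta

/-! ### The regularized net and its moderateness. -/

section Regularization

variable {d : ℕ} {Ω : Opens (EuclideanSpace ℝ (Fin d))} (ρ : 𝓢(EuclideanSpace ℝ (Fin d), ℂ))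
  {χ : 𝓓((⊤ : Opens (EuclideanSpace ℝ (Fin d))), ℝ)}

/-- The reflected mollifier `x ↦ θ_ε (-x)`. -/
noncomputable def thetaNeg (hχ_zero : ∀ x, 2 ≤ ‖x‖ → χ x = 0) (ε : Set.Ioc (0 : ℝ) 1) :
    BddSmooth (EuclideanSpace ℝ (Fin d)) :=
  ⟨fun x => theta ρ χ ε (-x), (isBddSmooth_theta ρ hχ_zero ε).comp_neg⟩

theorem cutConv_theta_eq_smoothing (hχ_zero : ∀ x, 2 ≤ ‖x‖ → χ x = 0) (κ : 𝓓(Ω, ℝ))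
    (T : Distr Ω) (ε : Set.Ioc (0 : ℝ) 1) (y : EuclideanSpace ℝ (Fin d)) :
    cutConv κ T (theta ρ χ ε) (contDiff_theta ρ χ ε) y =
      smoothing (cutFunctional κ T) (thetaNeg ρ hχ_zero ε) y := by
  refine congrArg T (TestFunction.ext fun x => ?_)
  change κ x • theta ρ χ ε (y - x) = κ x • theta ρ χ ε (-(x - y))
  rw [neg_sub]

theorem contDiff_cutConv_theta (hχ_zero : ∀ x, 2 ≤ ‖x‖ → χ x = 0) (κ : 𝓓(Ω, ℝ)) (T : Distr Ω)
    (ε : Set.Ioc (0 : ℝ) 1) :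
    ContDiff ℝ ∞ (cutConv κ T (theta ρ χ ε) (contDiff_theta ρ χ ε)) := by
  obtain ⟨N, C, h⟩ := exists_seminormBound_cutFunctional κ T
  rw [funext (cutConv_theta_eq_smoothing ρ hχ_zero κ T ε)]
  exact contDiff_smoothing h _

/-- The restriction to `Ω` of a smooth function on the whole space. -/
noncomputable def SmoothFn.ofContDiff (f : EuclideanSpace ℝ (Fin d) → ℂ) (hf : ContDiff ℝ ∞ f) :
    SmoothFn Ω :=
  ⟨fun y => f y, hf.contDiffOn.congr fun x hx => zeroExt_apply _ (⟨x, hx⟩ : Ω)⟩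

theorem zeroExt_eventuallyEq {f : Ω → ℂ} {g : EuclideanSpace ℝ (Fin d) → ℂ}
    {U : Set (EuclideanSpace ℝ (Fin d))} (hU : IsOpen U)
    (h : ∀ y : Ω, (y : EuclideanSpace ℝ (Fin d)) ∈ U → f y = g y)
    {x : EuclideanSpace ℝ (Fin d)} (hxU : x ∈ U) (hx : x ∈ Ω) : zeroExt Ω f =ᶠ[𝓝 x] g := by
  filter_upwards [hU.mem_nhds hxU, Ω.isOpen.mem_nhds hx] with y hy hyΩ
  exact (zeroExt_apply f ⟨y, hyΩ⟩).trans (h ⟨y, hyΩ⟩ hy)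

theorem iteratedFDeriv_zeroExt_ofContDiff {f : EuclideanSpace ℝ (Fin d) → ℂ}
    (hf : ContDiff ℝ ∞ f) (i : ℕ) {x : EuclideanSpace ℝ (Fin d)} (hx : x ∈ Ω) :
    iteratedFDeriv ℝ i (zeroExt Ω (SmoothFn.ofContDiff f hf : SmoothFn Ω)) x =
      iteratedFDeriv ℝ i f x :=
  (Filter.EventuallyEq.iteratedFDeriv ℝ (zeroExt_eventuallyEq isOpen_univ (fun _ _ => rfl)
    (Set.mem_univ _) hx) i).eq_of_nhds

/-- The net `((κ_ε T) ∗ θ_ε)_ε`. -/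
noncomputable def regularization (hχ_zero : ∀ x, 2 ≤ ‖x‖ → χ x = 0)
    (κ : Set.Ioc (0 : ℝ) 1 → 𝓓(Ω, ℝ)) (T : Distr Ω) : Net Ω := fun ε =>
  SmoothFn.ofContDiff _ (contDiff_cutConv_theta ρ hχ_zero (κ ε) T ε)

theorem cutMul_eq_of_eq_one {κ : 𝓓(Ω, ℝ)} {K : Set (EuclideanSpace ℝ (Fin d))}
    (hκ : ∀ x ∈ K, κ x = 1) {ψ : EuclideanSpace ℝ (Fin d) → ℂ} (hψ : ContDiff ℝ ∞ ψ)
    (hψK : ∀ x, ψ x ≠ 0 → x ∈ K) : (cutMul κ ψ hψ : EuclideanSpace ℝ (Fin d) → ℂ) = ψ := by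
  funext x
  change κ x • ψ x = ψ x
  by_cases h : ψ x = 0
  · rw [h, smul_zero]
  · rw [hκ x (hψK x h), one_smul]

theorem isLittleO_inv_pow_succ (q : ℕ) :
    (fun ε : Set.Ioc (0 : ℝ) 1 => ((ε : ℝ) ^ q)⁻¹) =o[atZero] fun ε => ((ε : ℝ) ^ (q + 1))⁻¹ := by
  have h := (isBigO_refl (fun ε : Set.Ioc (0 : ℝ) 1 => ((ε : ℝ) ^ q)⁻¹) atZero).mul_isLittleO
    (isLittleO_const_inv 1)
  simpa only [mul_one, ← mul_inv, ← pow_add] using h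

theorem isModerate_regularization (hχ_zero : ∀ x, 2 ≤ ‖x‖ → χ x = 0)
    {κ : Set.Ioc (0 : ℝ) 1 → 𝓓(Ω, ℝ)}
    (hκ_one : ∀ ε : Set.Ioc (0 : ℝ) 1, ∀ x ∈ exhaustion Ω (ε : ℝ), κ ε x = 1) (T : Distr Ω) :
    IsModerate (regularization ρ hχ_zero κ T) := by
  intro l K hK hKΩ
  obtain ⟨K', U, hK', hK'Ω, -, hKU, -, hloc⟩ :=
    exists_localization ρ hχ_zero hκ_one hK hKΩ
  obtain ⟨N, C, hC, hT⟩ := T.exists_bound hK' hK'Ω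
  choose B hB0 hB using exists_norm_iteratedFDeriv_theta_le ρ χ
  -- At most `l` derivatives come from the seminorm and `N` from the order of `T` on `K'`; the extra
  -- `1` turns `O` into `o`.
  refine ⟨d + (l + N) + 1, IsBigO.trans_isLittleO
    (IsBigO.of_bound (C * ∑ k ∈ Finset.range (l + N + 1), B k) ?_)
    (isLittleO_inv_pow_succ (d + (l + N)))⟩
  filter_upwards [hloc] with ε ⟨hε, hκ1, hsupp⟩
  have h0 : (0 : ℝ) < ε := ε.2.1
  have hS0 : 0 ≤ ∑ k ∈ Finset.range (l + N + 1), B k := Finset.sum_nonneg fun k _ => hB0 k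
  rw [Real.norm_of_nonneg (smoothSeminorm_nonneg _), Real.norm_of_nonneg (by positivity)]
  refine smoothSeminorm_le (by positivity) fun i hi y hy => ?_
  rw [regularization, iteratedFDeriv_zeroExt_ofContDiff _ _ (hKΩ hy),
    funext (cutConv_theta_eq_smoothing ρ hχ_zero (κ ε) T ε)]
  -- These constants depend on `ε` and serve only to justify differentiation; the estimate uses `N`
  -- and `C`, which belong to `K'`.
  obtain ⟨N', C', hL⟩ := exists_seminormBound_cutFunctional (κ ε) T
  refine ContinuousMultilinearMap.opNorm_le_bound (by positivity) fun m => ?_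
  rw [iteratedFDeriv_smoothing_apply hL, norm_mul, norm_pow, norm_neg, norm_one, one_pow, one_mul]
  set η := thetaNeg ρ hχ_zero ε with hη
  set ψ := translate (dirDerivs η i m) y with hψ
  have hψK : ∀ x, (ψ : EuclideanSpace ℝ (Fin d) → ℂ) x ≠ 0 → x ∈ K' := by
    intro x hx
    have h1 : (ψ : EuclideanSpace ℝ (Fin d) → ℂ) x =
        iteratedFDeriv ℝ i (translate η y : EuclideanSpace ℝ (Fin d) → ℂ) x m := by
      change iteratedFDeriv ℝ i (η : EuclideanSpace ℝ (Fin d) → ℂ) (x - y) m =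
        iteratedFDeriv ℝ i (fun z => (η : EuclideanSpace ℝ (Fin d) → ℂ) (z - y)) x m
      rw [iteratedFDeriv_comp_sub]
    have h2 : x ∈ tsupport (translate η y : EuclideanSpace ℝ (Fin d) → ℂ) := by
      refine support_iteratedFDeriv_subset (𝕜 := ℝ) i fun h => hx ?_
      rw [h1, h]
      rfl
    refine closure_minimal (fun z hz => ?_) hK'.isClosed h2
    refine hsupp y (hKU hy) z ?_
    have h3 : theta ρ χ ε (-(z - y)) ≠ 0 := hz
    rwa [neg_sub] at h3
  have hcut := cutMul_eq_of_eq_one hκ1 ψ.2.1 hψK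
  have h1 : ‖T (cutMul (κ ε) ψ ψ.2.1)‖ ≤
      C * ((∑ k ∈ Finset.range (l + N + 1), B k) * ((ε : ℝ) ^ (d + (l + N)))⁻¹ * ∏ j, ‖m j‖) := by
    refine hT _ (fun x hx => ?_) _ fun j hj x => ?_
    · rw [hcut]
      by_contra h
      exact hx (hψK x h)
    · rw [hcut]
      have h2 : ‖iteratedFDeriv ℝ j (ψ : EuclideanSpace ℝ (Fin d) → ℂ) x‖ ≤
          ‖iteratedFDeriv ℝ (i + j) (η : EuclideanSpace ℝ (Fin d) → ℂ) (x - y)‖ *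
            ∏ j, ‖m j‖ := by
        refine le_trans (le_of_eq ?_)
          (norm_iteratedFDeriv_iteratedFDeriv_apply_le j i (x - y) η.2.1 m)
        change ‖iteratedFDeriv ℝ j (fun z => (dirDerivs η i m : EuclideanSpace ℝ (Fin d) → ℂ)
          (z - y)) x‖ = _
        rw [iteratedFDeriv_comp_sub]
        rfl
      refine h2.trans (mul_le_mul_of_nonneg_right ?_ (by positivity))
      have h3 := norm_iteratedFDeriv_comp_neg (i + j) (theta ρ χ ε) (x - y)
      refine (h3.trans_le (hB (i + j) ε hε _)).trans ?_
      have hij : i + j ≤ l + N := add_le_add hi hj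
      refine mul_le_mul (Finset.single_le_sum (f := B) (fun k _ => hB0 k)
        (Finset.mem_range.2 (Nat.lt_succ_of_le hij))) ?_ (by positivity) hS0
      exact inv_anti₀ (by positivity)
        (pow_le_pow_of_le_one h0.le ε.2.2 (Nat.add_le_add_left hij d))
  refine h1.trans (le_of_eq ?_)
  ring

/-- The linear map `T ↦ ((κ_ε T) ∗ θ_ε)_ε` with values in the moderate nets. -/
noncomputable def regularizationLM (hχ_zero : ∀ x, 2 ≤ ‖x‖ → χ x = 0)
    {κ : Set.Ioc (0 : ℝ) 1 → 𝓓(Ω, ℝ)}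
    (hκ_one : ∀ ε : Set.Ioc (0 : ℝ) 1, ∀ x ∈ exhaustion Ω (ε : ℝ), κ ε x = 1) :
    Distr Ω →ₗ[ℂ] Moderate Ω where
  toFun T := ⟨regularization ρ hχ_zero κ T, isModerate_regularization ρ hχ_zero hκ_one T⟩
  map_add' _ _ := rfl
  map_smul' _ _ := rfl

end Regularization

/-- Needed to pick one admissible `ε₀` and to pass to the limit in inequalities. -/
instance : NeBot atZero := by
  refine comap_neBot fun t ht => ?_
  obtain ⟨r, hr, h⟩ := Metric.mem_nhds_iff.1 ht
  refine ⟨⟨min (r / 2) 1, by positivity, min_le_right _ _⟩, h ?_⟩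
  rw [Metric.mem_ball, dist_zero_right, Real.norm_of_nonneg (by positivity)]
  exact (min_le_left _ _).trans_lt (half_lt_self hr)

/-! ### Approximation of derivatives, and reflection. -/

section Approximation

variable {E : Type} [NormedAddCommGroup E] [NormedSpace ℝ E] [FiniteDimensional ℝ E]
  [MeasureSpace E] [BorelSpace E] [(volume : Measure E).IsAddHaarMeasure]

/-- Derivatives pass onto `g`, so `happ` is applied to `u = ∂^i g` contracted with `m`, with `A * ∏
j, ‖m j‖` in place of `A`. -/
theorem norm_iteratedFDeriv_conv_sub_le {w g : E → ℂ} {n : ℕ} {c A : ℝ} (hc : 0 ≤ c)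
    (hw : LocallyIntegrable w)
    (happ : ∀ u : E → ℂ, ContDiff ℝ ∞ u → ∀ A : ℝ, (∀ x, ‖u x‖ ≤ A) →
      (∀ x, ‖iteratedFDeriv ℝ n u x‖ ≤ A) → ∀ y, ‖conv w u y - u y‖ ≤ c * A)
    (hg : ContDiff ℝ ∞ g) (hgc : HasCompactSupport g) (i : ℕ)
    (hA : ∀ x, ‖iteratedFDeriv ℝ i g x‖ ≤ A) (hA' : ∀ x, ‖iteratedFDeriv ℝ (i + n) g x‖ ≤ A)
    (y : E) : ‖iteratedFDeriv ℝ i (conv w g - g) y‖ ≤ c * A := by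
  have hA0 : 0 ≤ A := (norm_nonneg _).trans (hA 0)
  refine ContinuousMultilinearMap.opNorm_le_bound (by positivity) fun m => ?_
  rw [iteratedFDeriv_sub_apply ((contDiff_conv hw hg hgc).of_le (mod_cast le_top)).contDiffAt
    (hg.of_le (mod_cast le_top)).contDiffAt, sub_apply,
    iteratedFDeriv_conv_apply hw hg hgc, mul_assoc]
  refine happ _ (contDiff_iteratedFDeriv_apply hg i m) _ (fun x => ?_) (fun x => ?_) y
  · exact (ContinuousMultilinearMap.le_opNorm _ _).trans
      (mul_le_mul_of_nonneg_right (hA x) (by positivity))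
  · exact (norm_iteratedFDeriv_iteratedFDeriv_apply_le n i x hg m).trans
      (mul_le_mul_of_nonneg_right (hA' x) (by positivity))

theorem conv_comp_neg (w u : E → ℂ) (y : E) :
    conv (fun x => w (-x)) u y = conv w (fun x => u (-x)) (-y) := by
  rw [conv, conv, ← integral_neg_eq_self]
  simp [add_comm]

theorem conv_comm (f g : E → ℂ) : conv f g = conv g f := by
  funext x
  rw [conv, conv, ← integral_sub_left_eq_self _ _ x]
  simp [mul_comm]

end Approximation

/-! ### Consistency with smooth functions, and injectivity. -/

section Regularization

variable {d : ℕ} {Ω : Opens (EuclideanSpace ℝ (Fin d))} {ρ : 𝓢(EuclideanSpace ℝ (Fin d), ℂ)}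
  {χ : 𝓓((⊤ : Opens (EuclideanSpace ℝ (Fin d))), ℝ)} {κ : Set.Ioc (0 : ℝ) 1 → 𝓓(Ω, ℝ)}

theorem contDiff_smul_zeroExt (κ : 𝓓(Ω, ℝ)) (f : SmoothFn Ω) :
    ContDiff ℝ ∞ fun x => κ x • zeroExt Ω f x := by
  refine contDiff_iff_contDiffAt.2 fun x => ?_
  by_cases hx : x ∈ tsupport κ
  · have hxΩ := κ.tsupport_subset hx
    exact κ.contDiff.contDiffAt.smul ((f.2 x hxΩ).contDiffAt (Ω.isOpen.mem_nhds hxΩ))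
  · refine (contDiffAt_const (c := (0 : ℂ))).congr_of_eventuallyEq ?_
    filter_upwards [(isClosed_tsupport κ).isOpen_compl.mem_nhds hx] with z hz
    rw [image_eq_zero_of_notMem_tsupport hz, zero_smul]

/-- The constant net. -/
def constNet (f : SmoothFn Ω) : Net Ω := fun _ => f

theorem isNegligible_regularization_ofSmooth_sub (hρ_int : ∫ x, ρ x = 1)
    (hρ_mom : ∀ m : Fin d → ℕ, m ≠ 0 → ∫ x, (∏ i, ((x i : ℝ) : ℂ) ^ m i) * ρ x = 0)
    (hχ_range : ∀ x, 0 ≤ χ x ∧ χ x ≤ 1) (hχ_one : ∀ x, ‖x‖ ≤ 1 → χ x = 1)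
    (hχ_zero : ∀ x, 2 ≤ ‖x‖ → χ x = 0)
    (hκ_one : ∀ ε : Set.Ioc (0 : ℝ) 1, ∀ x ∈ exhaustion Ω (ε : ℝ), κ ε x = 1) (f : SmoothFn Ω) :
    IsNegligible (regularization ρ hχ_zero κ (ofSmooth f) - constNet f) := by
  intro l K hK hKΩ p
  obtain ⟨K', U, hK', hK'Ω, hU, hKU, hUK', hloc⟩ :=
    exists_localization ρ hχ_zero hκ_one hK hKΩ
  -- A single cutoff `κ ε₀`, equal to one on `K'`, replaces `f` by a compactly supported `g`
  -- independent of `ε`; near `K` the net minus `f` is then `θ_ε * g - g`.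
  obtain ⟨ε₀, -, hκ₀, -⟩ := hloc.exists
  obtain ⟨C, hC, happ⟩ := exists_norm_conv_theta_sub_le hρ_int hρ_mom hχ_range hχ_one p
  set g : EuclideanSpace ℝ (Fin d) → ℂ := fun x => κ ε₀ x • zeroExt Ω f x with hg_def
  have hg : ContDiff ℝ ∞ g := contDiff_smul_zeroExt _ _
  have hgc : HasCompactSupport g := (κ ε₀).hasCompactSupport.smul_right
  choose B hB using (isBddSmooth_of_hasCompactSupport hg hgc).2
  have hB0 : ∀ j, 0 ≤ B j := fun j => (norm_nonneg _).trans (hB j 0)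
  set A := ∑ i ∈ Finset.range (l + 1), (B i + B (i + (2 * p + 1 + 1))) with hA_def
  have hterm : ∀ i ≤ l, B i + B (i + (2 * p + 1 + 1)) ≤ A := fun i hi =>
    Finset.single_le_sum (f := fun i => B i + B (i + (2 * p + 1 + 1)))
      (fun i _ => add_nonneg (hB0 _) (hB0 _)) (Finset.mem_range.2 (Nat.lt_succ_of_le hi))
  have hA0 : 0 ≤ A := (add_nonneg (hB0 _) (hB0 _)).trans (hterm 0 (Nat.zero_le _))
  have hlit : (fun ε : Set.Ioc (0 : ℝ) 1 => (ε : ℝ) ^ (p + 1)) =o[atZero]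
      fun ε => (ε : ℝ) ^ p :=
    (isLittleO_pow_pow (𝕜 := ℝ) (Nat.lt_succ_self p)).comp_tendsto tendsto_comap
  refine IsBigO.trans_isLittleO (IsBigO.of_bound (C * A) ?_) hlit
  filter_upwards [hloc] with ε ⟨hε, hκ1, hsupp⟩
  have h0 : (0 : ℝ) < ε := ε.2.1
  rw [Real.norm_of_nonneg (smoothSeminorm_nonneg _), Real.norm_of_nonneg (by positivity)]
  have heq : ∀ y : Ω, (y : EuclideanSpace ℝ (Fin d)) ∈ U →
      (((regularization ρ hχ_zero κ (ofSmooth f) - constNet f) ε : SmoothFn Ω) : Ω → ℂ) y =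
        (conv (theta ρ χ ε) g - g) y := by
    intro y hy
    have h1 : g y = (f : Ω → ℂ) y := by
      rw [hg_def]
      simp only [hκ₀ y (hUK' hy), one_smul]
      exact zeroExt_apply _ _
    have h2 : cutConv (κ ε) (ofSmooth f) (theta ρ χ ε) (contDiff_theta ρ χ ε) y =
        conv (theta ρ χ ε) g y := by
      rw [cutConv, ofSmooth_apply, conv,
        ← integral_sub_left_eq_self _ _ (y : EuclideanSpace ℝ (Fin d))]
      refine integral_congr_ae (Eventually.of_forall fun x => ?_)
      change κ ε (y - x) • theta ρ χ ε (y - (y - x)) * zeroExt Ω f (y - x) = _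
      rw [sub_sub_cancel]
      by_cases hx : theta ρ χ ε x = 0
      · simp [hx]
      · have hxK : (y : EuclideanSpace ℝ (Fin d)) - x ∈ K' :=
          hsupp y hy _ (by rwa [sub_sub_cancel])
        simp only [hg_def, hκ1 _ hxK, hκ₀ _ hxK, one_smul]
    change cutConv (κ ε) (ofSmooth f) (theta ρ χ ε) (contDiff_theta ρ χ ε) y - (f : Ω → ℂ) y =
      conv (theta ρ χ ε) g y - g y
    rw [h1, h2]
  refine smoothSeminorm_le (by positivity) fun i hi y hy => ?_
  rw [(Filter.EventuallyEq.iteratedFDeriv ℝ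
    (zeroExt_eventuallyEq hU heq (hKU hy) (hKΩ hy)) i).eq_of_nhds]
  refine (norm_iteratedFDeriv_conv_sub_le (c := C * (ε : ℝ) ^ (p + 1)) (A := A)
    (n := 2 * p + 1 + 1) (by positivity) (contDiff_theta ρ χ ε).continuous.locallyIntegrable
    (fun u hu A h1 h2 y => ?_) hg hgc i (fun x => ?_) (fun x => ?_) y).trans (le_of_eq (by ring))
  · exact (happ ε hε u hu A h1 h2 y).trans (le_of_eq (by ring))
  · exact (hB i x).trans ((le_add_of_nonneg_right (hB0 _)).trans (hterm i hi))
  · exact (hB _ x).trans ((le_add_of_nonneg_left (hB0 _)).trans (hterm i hi))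

/-- Only the decay to zero of the sup norm on `supp φ` is used: `T φ` is split into the pairing of
`φ` with the net and an error of size `O(ε)`. -/
theorem eq_zero_of_isNegligible_regularization (hρ_int : ∫ x, ρ x = 1)
    (hρ_mom : ∀ m : Fin d → ℕ, m ≠ 0 → ∫ x, (∏ i, ((x i : ℝ) : ℂ) ^ m i) * ρ x = 0)
    (hχ_range : ∀ x, 0 ≤ χ x ∧ χ x ≤ 1) (hχ_one : ∀ x, ‖x‖ ≤ 1 → χ x = 1)
    (hχ_zero : ∀ x, 2 ≤ ‖x‖ → χ x = 0)
    (hκ_one : ∀ ε : Set.Ioc (0 : ℝ) 1, ∀ x ∈ exhaustion Ω (ε : ℝ), κ ε x = 1) {T : Distr Ω}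
    (hT : IsNegligible (regularization ρ hχ_zero κ T)) : T = 0 := by
  refine ContinuousLinearMap.ext fun φ => ?_
  set K := tsupport φ with hK_def
  have hK : IsCompact K := φ.hasCompactSupport
  have hKΩ : K ⊆ Ω := φ.tsupport_subset
  have hφK : ∀ x, φ x ≠ 0 → x ∈ K := fun x hx => subset_tsupport φ hx
  obtain ⟨K', U, hK', hK'Ω, hU, hKU, hUK', hloc⟩ :=
    exists_localization ρ hχ_zero hκ_one hK hKΩ
  obtain ⟨N, D, hD, hTb⟩ := T.exists_bound hK' hK'Ω
  obtain ⟨C, hC, happ⟩ := exists_norm_conv_theta_sub_le hρ_int hρ_mom hχ_range hχ_one 0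
  choose B hB using (isBddSmooth_of_hasCompactSupport φ.contDiff φ.hasCompactSupport).2
  have hB0 : ∀ j, 0 ≤ B j := fun j => (norm_nonneg _).trans (hB j 0)
  set A := ∑ i ∈ Finset.range (N + 1), (B i + B (i + (2 * 0 + 1 + 1))) with hA_def
  have hterm : ∀ i ≤ N, B i + B (i + (2 * 0 + 1 + 1)) ≤ A := fun i hi =>
    Finset.single_le_sum (f := fun i => B i + B (i + (2 * 0 + 1 + 1)))
      (fun i _ => add_nonneg (hB0 _) (hB0 _)) (Finset.mem_range.2 (Nat.lt_succ_of_le hi))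
  have hA0 : 0 ≤ A := (add_nonneg (hB0 _) (hB0 _)).trans (hterm 0 (Nat.zero_le _))
  have hev : ∀ᶠ ε in atZero, ‖T φ‖ ≤
      (∫ y, ‖φ y‖) * smoothSeminorm K 0 (regularization ρ hχ_zero κ T ε) +
        D * (C * (ε : ℝ) * A) := by
    filter_upwards [hloc] with ε ⟨hε, hκ1, hsupp⟩
    have h0 : (0 : ℝ) < ε := ε.2.1
    set η := thetaNeg ρ hχ_zero ε with hη
    have hηc : HasCompactSupport (η : EuclideanSpace ℝ (Fin d) → ℂ) :=
      (hasCompactSupport_theta ρ hχ_zero hε).comp_homeomorph (Homeomorph.neg _)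
    have hηl : LocallyIntegrable (η : EuclideanSpace ℝ (Fin d) → ℂ) :=
      η.2.1.continuous.locallyIntegrable
    have hqK : ∀ x, conv φ η x ≠ 0 → x ∈ K' := by
      intro x hx
      by_contra h
      refine hx ?_
      rw [conv]
      refine integral_eq_zero_of_ae (Eventually.of_forall fun t => ?_)
      by_cases ht : φ t = 0
      · simp [ht]
      · have h1 : theta ρ χ ε (t - x) = 0 := by
          by_contra h2
          exact h (hsupp t (hKU (hφK t ht)) x h2)
        have h2 : (η : EuclideanSpace ℝ (Fin d) → ℂ) (x - t) = theta ρ χ ε (-(x - t)) := rfl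
        change φ t * (η : EuclideanSpace ℝ (Fin d) → ℂ) (x - t) = 0
        rw [h2, neg_sub, h1, mul_zero]
    have hqd : ContDiff ℝ ∞ (conv φ η) :=
      contDiff_conv φ.continuous.locallyIntegrable η.2.1 hηc
    let q : BddSmooth (EuclideanSpace ℝ (Fin d)) :=
      ⟨conv φ η, isBddSmooth_of_hasCompactSupport hqd
        (HasCompactSupport.intro hK' fun x hx => by
          by_contra h
          exact hx (hqK x h))⟩
    obtain ⟨N', C', hL⟩ := exists_seminormBound_cutFunctional (κ ε) T
    -- Here `q = φ * θ̌_ε`, so the pairing of the net with `φ` becomes `⟨T, κ_ε q⟩`, and `κ_ε q = q`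
    -- because `q` is supported in `K'`.
    have hex := integral_mul_smoothing hL η hηc φ.continuous φ.hasCompactSupport q rfl
    have hcut := cutMul_eq_of_eq_one hκ1 q.2.1 hqK
    -- The estimate for `θ_ε` transfers to its reflection by reflecting `u` and `y` as well.
    have happ' : ∀ u : EuclideanSpace ℝ (Fin d) → ℂ, ContDiff ℝ ∞ u → ∀ A : ℝ,
        (∀ x, ‖u x‖ ≤ A) → (∀ x, ‖iteratedFDeriv ℝ (2 * 0 + 1 + 1) u x‖ ≤ A) →
          ∀ y, ‖conv (η : EuclideanSpace ℝ (Fin d) → ℂ) u y - u y‖ ≤ C * (ε : ℝ) * A := by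
      intro u hu A h1 h2 y
      have h3 := happ ε hε (fun x => u (-x)) (hu.comp contDiff_neg) A (fun x => h1 _)
        (fun x => (norm_iteratedFDeriv_comp_neg _ u x).trans_le (h2 _)) (-y)
      have h4 : conv (η : EuclideanSpace ℝ (Fin d) → ℂ) u y =
          conv (theta ρ χ ε) (fun x => u (-x)) (-y) := conv_comp_neg _ _ _
      rw [h4]
      rw [neg_neg] at h3
      exact h3.trans (le_of_eq (by ring))
    have hdiff : ‖T (cutMul (κ ε) q q.2.1 - φ)‖ ≤ D * (C * (ε : ℝ) * A) := by
      have hfun : ((cutMul (κ ε) q q.2.1 - φ : 𝓓(Ω, ℂ)) : EuclideanSpace ℝ (Fin d) → ℂ) =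
          conv η φ - φ := by
        rw [FunLike.coe_sub, hcut, conv_comm]
      refine hTb _ (fun x hx => ?_) _ fun i hi x => ?_
      · have h1 : conv φ η x = 0 := by
          by_contra h
          exact hx (hqK x h)
        have h2 : φ x = 0 := by
          by_contra h
          exact hx (hUK' (hKU (hφK x h)))
        rw [hfun, Pi.sub_apply, conv_comm, h1, h2, sub_zero]
      · rw [hfun]
        exact norm_iteratedFDeriv_conv_sub_le (by positivity) hηl happ' φ.contDiff
          φ.hasCompactSupport i
          (fun x => (hB i x).trans ((le_add_of_nonneg_right (hB0 _)).trans (hterm i hi)))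
          (fun x => (hB _ x).trans ((le_add_of_nonneg_left (hB0 _)).trans (hterm i hi))) x
    have hint : ‖T (cutMul (κ ε) q q.2.1)‖ ≤
        (∫ y, ‖φ y‖) * smoothSeminorm K 0 (regularization ρ hχ_zero κ T ε) := by
      have h1 : T (cutMul (κ ε) q q.2.1) =
          ∫ y, φ y * smoothing (cutFunctional (κ ε) T) η y := hex.symm
      rw [h1, ← integral_mul_const]
      refine norm_integral_le_of_norm_le
        ((φ.continuous.norm.integrable_of_hasCompactSupport φ.hasCompactSupport.norm).mul_const _)
        (Eventually.of_forall fun y => ?_)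
      rw [norm_mul]
      by_cases hy : φ y = 0
      · simp [hy]
      · refine mul_le_mul_of_nonneg_left ?_ (norm_nonneg _)
        have h2 := le_smoothSeminorm hK hKΩ (regularization ρ hχ_zero κ T ε) (le_refl 0)
          (hφK y hy)
        rw [regularization, iteratedFDeriv_zeroExt_ofContDiff _ _ (hKΩ (hφK y hy)),
          norm_iteratedFDeriv_zero, cutConv_theta_eq_smoothing ρ hχ_zero] at h2
        exact h2
    have hTφ : T φ = T (cutMul (κ ε) q q.2.1) - T (cutMul (κ ε) q q.2.1 - φ) := by
      rw [map_sub, sub_sub_cancel]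
    rw [hTφ]
    exact (norm_sub_le _ _).trans (add_le_add hint hdiff)
  have hp : Tendsto (fun ε => smoothSeminorm K 0 (regularization ρ hχ_zero κ T ε)) atZero
      (𝓝 0) := by
    have := hT 0 K hK hKΩ 0
    simp only [pow_zero] at this
    exact (isLittleO_one_iff ℝ).1 this
  have hε : Tendsto (fun ε : Set.Ioc (0 : ℝ) 1 => (ε : ℝ)) atZero (𝓝 0) := tendsto_comap
  have hlim := (hp.const_mul (∫ y, ‖φ y‖)).add (((hε.const_mul C).mul_const A).const_mul D)
  simp only [mul_zero, zero_mul, add_zero] at hlim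
  exact norm_le_zero_iff.1 (ge_of_tendsto hlim hev)

end Regularization

end Colombeau

/-! ### Assembly: the linear embedding into the quotient algebra. -/

theorem mainTheorem4 (d : ℕ) (Ω : TopologicalSpace.Opens (EuclideanSpace ℝ (Fin d)))
    -- the mollifier `ρ`: an even Schwartz function, of integral 1, all higher moments zero
    (ρ : 𝓢(EuclideanSpace ℝ (Fin d), ℂ))
    (hρ_even : ∀ x, ρ (-x) = ρ x)
    (hρ_int : ∫ x, ρ x = 1)
    (hρ_mom : ∀ m : Fin d → ℕ, m ≠ 0 → ∫ x, (∏ i, ((x i : ℝ) : ℂ) ^ m i) * ρ x = 0)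
    -- the cutoff `χ` of the mollifiers
    (χ : 𝓓((⊤ : TopologicalSpace.Opens (EuclideanSpace ℝ (Fin d))), ℝ))
    (hχ_range : ∀ x, 0 ≤ χ x ∧ χ x ≤ 1)
    (hχ_one : ∀ x, ‖x‖ ≤ 1 → χ x = 1)
    (hχ_zero : ∀ x, 2 ≤ ‖x‖ → χ x = 0)
    -- the cutoffs `κ_ε` of the distributions
    (κ : Set.Ioc (0 : ℝ) 1 → 𝓓(Ω, ℝ))
    (hκ_range : ∀ (ε : Set.Ioc (0 : ℝ) 1) x, 0 ≤ κ ε x ∧ κ ε x ≤ 1)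
    (hκ_one : ∀ ε : Set.Ioc (0 : ℝ) 1, ∀ x ∈ Colombeau.exhaustion Ω (ε : ℝ), κ ε x = 1) :
    ∃ ι : Colombeau.Distr Ω →ₗ[ℂ] Colombeau.G Ω,
      -- `ι T` is the class of the net `((κ_ε T) ∗ θ_ε)_ε`, which is smooth and moderate on `Ω`
      (∀ T : Colombeau.Distr Ω, ∃ f : Colombeau.Moderate Ω,
        (∀ (ε : Set.Ioc (0 : ℝ) 1) (y : Ω),
          ((f : Colombeau.Net Ω) ε : Ω → ℂ) y =
            Colombeau.cutConv (κ ε) T (Colombeau.theta ρ χ ε) (Colombeau.contDiff_theta ρ χ ε) y) ∧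
        ι T = Colombeau.cls f) ∧
      Function.Injective ι ∧
      ∀ f : Colombeau.SmoothFn Ω, ι (Colombeau.ofSmooth f) = Colombeau.sigma f := by
  let Φ := Colombeau.regularizationLM ρ hχ_zero hκ_one
  refine ⟨(Ideal.Quotient.mkₐ ℂ (Colombeau.Negligible Ω)).toLinearMap ∘ₗ Φ,
    fun T => ⟨Φ T, fun _ _ => rfl, rfl⟩, ?_, fun f => ?_⟩
  · refine (injective_iff_map_eq_zero _).2 fun T hT => ?_
    exact Colombeau.eq_zero_of_isNegligible_regularization hρ_int hρ_mom hχ_range hχ_one hχ_zero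
      hκ_one (Ideal.Quotient.eq_zero_iff_mem.1 hT)
  · exact Ideal.Quotient.eq.2 (Colombeau.isNegligible_regularization_ofSmooth_sub hρ_int hρ_mom
      hχ_range hχ_one hχ_zero hκ_one f)
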